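/- **Conventions.** Rational functions have complex coefficients, and poles and values are considered on the Riemann sphere $\mathbb C\cup\{\infty\}$; a pole of a rational matrix is a pole of one of its entries. For a rational matrix $W(z)$ put $W(z)^*=\overline{W(\bar z^{-1})}^{\top}$; for a constant matrix $A^*$ is the conjugate transpose and $A^{-*}=(A^{-1})^*$. A point $\alpha\in\mathbb C\cup\{\infty\}$ is a zero of $W$ if $W$ is analytic at $\alpha$ and $W(\alpha)v=0$ for some vector $v\ne0$. $W$ is *minimum-phase* if all its poles lie in the open unit disc and all its zeros lie in the closed unit disc (so $\infty$ is neither a pole nor a zero). A square rational matrix $Q$ is *inner* if all its poles lie in the open unit disc and $QQ^*=Q^*Q=I$. A *rational spectral density* is a square rational matrix $\Phi$ with $\Phi^*=\Phi$ that has no pole on the unit circle and is positive semidefinite at every point of the unit circle. A *spectral factor* of $\Phi$ is a rational $W$ with $\Phi=WW^*$. We write $$\left[\begin{array}{c|c}A&B\\\hline C&D\end{array}\right]:=C(zI-A)^{-1}B+D,$$ where the matrices may depend on $z$; a realization of $T(z)$ is such a representation of $T$ with constant $A,B,C,D$, and it is minimal if the size of $A$ is least possible among all realizations of $T$. **Theorem.**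 Let $m\ge1$, $p\ge0$, and let $$\Phi(z)=\begin{bmatrix}\Phi_{11}(z)&\Phi_{12}(z)\\\Phi_{21}(z)&\Phi_{22}(z)\end{bmatrix}$$ be an $(m+p)\times(m+p)$ rational spectral density of rank $m$ whose $m\times m$ block $\Phi_{11}$ has rank $m$. Put $H=\Phi_{21}\Phi_{11}^{-1}$, let $G_1$ be an $m\times m$ minimum-phase spectral factor of $\Phi_{11}$, and let $$G_1(z)^\top H(z)^\top=\left[\begin{array}{cc|c}A_u&A_{us}&B_u\\0&A_s&B_s\\\hline C_u&C_s&D\end{array}\right]$$ be a minimal realization in which all eigenvalues of $A_u$ satisfy $|\lambda|>1$ and all eigenvalues of $A_s$ satisfy $|\lambda|\le1$. Then the Stein equation $$X-A_u^*XA_u-C_u^*C_u=0$$ has exactly one solution $X$, and this $X$ is Hermitian and invertible. With this $X$ put $$M=-X^{-1}(I-A_u)^{-*}C_u^*,\quad R_u=(1-z)MC_u,\quad R_s=(1-z)MC_s,\quad R_D=(1-z)MD,$$ and for each $m\times m$ unitary matrix $P$ put $$W_2(z)=\left[\begin{array}{cc|c}A_u+R_u&A_{us}+R_s&B_u+R_D\\0&A_s&B_s\\\hline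 PC_u&PC_s&PD\end{array}\right]^\top,\qquad Q_1(z)=\left[\begin{array}{c|c}A_u+R_u&(1-z)M\\\hline PC_u&P\end{array}\right]^\top .$$ Then: 1. $Q_1$ is inner for every unitary $P$; 2. a rational $(m+p)\times m$ matrix $W$ is a minimum-phase spectral factor of $\Phi$ of full column rank $m$ if and only if $$W(z)=\begin{bmatrix}G_1(z)Q_1(z)\\W_2(z)\end{bmatrix}$$ for some unitary matrix $P$; 3. the pair $(Q_1,W_2)$ is unique once $P$ has been chosen: for a given unitary $P$, every minimal realization of $G_1^\top H^\top$ of the above block form gives the same $Q_1$ and $W_2$. -/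

import Mathlib

open scoped OnePoint Matrix ComplexOrder

noncomputable section

namespace LowRankSpectral

/-- Matrices of rational functions of `z` with complex coefficients. -/
abbrev RatMatrix (a b : Type) := Matrix a b (RatFunc ℂ)

/-- The rational function `r(1/z)`. -/
def invArg (r : RatFunc ℂ) : RatFunc ℂ :=
  RatFunc.eval RatFunc.C (RatFunc.X)⁻¹ r

/-- The para-conjugate `conj (r (1 / conj z))`: coefficients are conjugated and `z` is replaced
by `1/z`. On the unit circle it is the complex conjugate of `r`. -/
def paraConj (r : RatFunc ℂ) : RatFunc ℂ :=
  RatFunc.eval ((RatFunc.C : ℂ →+* RatFunc ℂ).comp (starRingEnd ℂ)) (RatFunc.X)⁻¹ r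

/-- The para-conjugate transpose `W(z)^* = conj (W (1 / conj z))ᵀ` of a rational matrix. -/
def paraStar {a b : Type} (W : RatMatrix a b) : RatMatrix b a :=
  (W.map paraConj)ᵀ

/-- `a` is a pole of `r`, for `a` on the Riemann sphere. The numerator and the denominator of an
element of `RatFunc ℂ` are coprime, so the finite poles are the roots of the denominator. -/
def IsPole (r : RatFunc ℂ) : OnePoint ℂ → Prop
  | ∞ => (invArg r).denom.eval 0 = 0
  | (z : ℂ) => r.denom.eval z = 0

/-- The value of `r` at a point of the Riemann sphere (meaningful where `r` has no pole). -/
def value (r : RatFunc ℂ) : OnePoint ℂ → ℂ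
  | ∞ => (invArg r).eval (RingHom.id ℂ) 0
  | (z : ℂ) => r.eval (RingHom.id ℂ) z

/-- `α` is a pole of the rational matrix `W`, i.e. of one of its entries. -/
def IsMatPole {a b : Type} (W : RatMatrix a b) (α : OnePoint ℂ) : Prop :=
  ∃ i j, IsPole (W i j) α

/-- The value of a rational matrix at a point of the Riemann sphere. -/
def matValue {a b : Type} (W : RatMatrix a b) (α : OnePoint ℂ) : Matrix a b ℂ :=
  W.map fun r => value r α

/-- `α` is a (right) zero of `W`: `W` is analytic at `α` and `W(α) v = 0` for some `v ≠ 0`. -/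
def IsMatZero {a b : Type} [Fintype b] (W : RatMatrix a b) (α : OnePoint ℂ) : Prop :=
  ¬ IsMatPole W α ∧ ∃ v : b → ℂ, v ≠ 0 ∧ matValue W α *ᵥ v = 0

/-- The open unit disc, in the Riemann sphere. -/
def openDisc : Set (OnePoint ℂ) := (fun z : ℂ => (z : OnePoint ℂ)) '' Metric.ball 0 1

/-- The closed unit disc, in the Riemann sphere. -/
def closedDisc : Set (OnePoint ℂ) := (fun z : ℂ => (z : OnePoint ℂ)) '' Metric.closedBall 0 1

/-- All poles in the open unit disc (in particular no pole at infinity). -/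
def IsStable {a b : Type} (W : RatMatrix a b) : Prop :=
  ∀ α, IsMatPole W α → α ∈ openDisc

/-- Minimum phase: all poles in the open unit disc and all zeros in the closed unit disc. -/
def IsMinimumPhase {a b : Type} [Fintype b] (W : RatMatrix a b) : Prop :=
  IsStable W ∧ ∀ α, IsMatZero W α → α ∈ closedDisc

/-- A square rational matrix is inner: it is stable and unitary on the unit circle. -/
def IsInner {a : Type} [Fintype a] [DecidableEq a] (Q : RatMatrix a a) : Prop :=
  IsStable Q ∧ Q * paraStar Q = 1 ∧ paraStar Q * Q = 1

/-- A rational spectral density in discrete time: para-Hermitian, without poles on the unit circle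
(that is, integrable there), and positive semidefinite on the unit circle. -/
def IsSpectralDensity {a : Type} [Fintype a] (Φ : RatMatrix a a) : Prop :=
  paraStar Φ = Φ ∧
    ∀ z : ℂ, ‖z‖ = 1 → ¬ IsMatPole Φ (z : OnePoint ℂ) ∧ (matValue Φ (z : OnePoint ℂ)).PosSemidef

/-- `W` is a spectral factor of `Φ`: `Φ = W W^*`. -/
def IsSpectralFactor {a b : Type} [Fintype b] (Φ : RatMatrix a a) (W : RatMatrix a b) : Prop :=
  Φ = W * paraStar W

/-- The deterministic relation `H = Φ₂₁ Φ₁₁⁻¹`. -/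
def detRelation {a b : Type} [Fintype a] [DecidableEq a] (Φ : RatMatrix (a ⊕ b) (a ⊕ b)) :
    RatMatrix b a :=
  Φ.toBlocks₂₁ * Φ.toBlocks₁₁⁻¹

/-- A constant matrix as a rational matrix. -/
def const {a b : Type} (A : Matrix a b ℂ) : RatMatrix a b := A.map RatFunc.C

/-- `[A | B; C | D] = C (z I - A)⁻¹ B + D`. The four matrices may themselves depend on `z`. -/
def transfer {n a b : Type} [Fintype n] [DecidableEq n]
    (A : RatMatrix n n) (B : RatMatrix n b) (C : RatMatrix a n) (D : RatMatrix a b) :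
    RatMatrix a b :=
  C * ((RatFunc.X : RatFunc ℂ) • (1 : RatMatrix n n) - A)⁻¹ * B + D

/-- The constant matrices `A, B, C, D` are a (state-space) realization of `T`. -/
def IsRealization {n a b : Type} [Fintype n] [DecidableEq n] (T : RatMatrix a b)
    (A : Matrix n n ℂ) (B : Matrix n b ℂ) (C : Matrix a n ℂ) (D : Matrix a b ℂ) : Prop :=
  T = transfer (const A) (const B) (const C) (const D)

/-- A minimal realization: one of least state dimension. -/
def IsMinimalRealization {n a b : Type} [Fintype n] [DecidableEq n] (T : RatMatrix a b)
    (A : Matrix n n ℂ) (B : Matrix n b ℂ) (C : Matrix a n ℂ) (D : Matrix a b ℂ) : Prop :=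
  IsRealization T A B C D ∧
    ∀ (k : ℕ) (A' : Matrix (Fin k) (Fin k) ℂ) (B' : Matrix (Fin k) b ℂ) (C' : Matrix a (Fin k) ℂ)
      (D' : Matrix a b ℂ), IsRealization T A' B' C' D' → Fintype.card n ≤ k

/-- The matrices of a block upper triangular state-space system
`[A_u A_us | B_u; 0 A_s | B_s; C_u C_s | D]` with `m` outputs and `p` inputs. -/
structure BlockSystem (m p nu ns : ℕ) where
  Au : Matrix (Fin nu) (Fin nu) ℂ
  Aus : Matrix (Fin nu) (Fin ns) ℂ
  As : Matrix (Fin ns) (Fin ns) ℂ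
  Bu : Matrix (Fin nu) (Fin p) ℂ
  Bs : Matrix (Fin ns) (Fin p) ℂ
  Cu : Matrix (Fin m) (Fin nu) ℂ
  Cs : Matrix (Fin m) (Fin ns) ℂ
  D : Matrix (Fin m) (Fin p) ℂ

namespace BlockSystem

variable {m p nu ns : ℕ} (S : BlockSystem m p nu ns)

/-- `S` is a minimal realization of `T` split into its unstable part (eigenvalues of `A_u` outside
the closed unit disc) and its stable part (eigenvalues of `A_s` in the closed unit disc). -/
def IsSplitMinimalRealization (T : RatMatrix (Fin m) (Fin p)) : Prop :=
  IsMinimalRealization T (Matrix.fromBlocks S.Au S.Aus 0 S.As) (Matrix.fromRows S.Bu S.Bs)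
      (Matrix.fromCols S.Cu S.Cs) S.D ∧
    (∀ μ ∈ spectrum ℂ S.Au, 1 < ‖μ‖) ∧ ∀ μ ∈ spectrum ℂ S.As, ‖μ‖ ≤ 1

/-- The Stein equation `X - A_u^* X A_u - C_u^* C_u = 0`. -/
def Stein (X : Matrix (Fin nu) (Fin nu) ℂ) : Prop :=
  X - S.Auᴴ * X * S.Au - S.Cuᴴ * S.Cu = 0

/-- `M = -X⁻¹ (I - A_u)^{-*} C_u^*`. -/
def M (X : Matrix (Fin nu) (Fin nu) ℂ) : Matrix (Fin nu) (Fin m) ℂ :=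
  -(X⁻¹ * ((1 - S.Au)⁻¹)ᴴ * S.Cuᴴ)

/-- `(1 - z) M`. -/
def zM (X : Matrix (Fin nu) (Fin nu) ℂ) : RatMatrix (Fin nu) (Fin m) :=
  (1 - RatFunc.X : RatFunc ℂ) • const (S.M X)

/-- `R_u = (1 - z) M C_u`. -/
def Ru (X : Matrix (Fin nu) (Fin nu) ℂ) : RatMatrix (Fin nu) (Fin nu) := S.zM X * const S.Cu

/-- `R_s = (1 - z) M C_s`. -/
def Rs (X : Matrix (Fin nu) (Fin nu) ℂ) : RatMatrix (Fin nu) (Fin ns) := S.zM X * const S.Cs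

/-- `R_D = (1 - z) M D`. -/
def RD (X : Matrix (Fin nu) (Fin nu) ℂ) : RatMatrix (Fin nu) (Fin p) := S.zM X * const S.D

/-- `W₂ = [A_u + R_u, A_us + R_s | B_u + R_D; 0, A_s | B_s; P C_u, P C_s | P D]ᵀ`. -/
def W₂ (X : Matrix (Fin nu) (Fin nu) ℂ) (P : Matrix (Fin m) (Fin m) ℂ) :
    RatMatrix (Fin p) (Fin m) :=
  (transfer
    (Matrix.fromBlocks (const S.Au + S.Ru X) (const S.Aus + S.Rs X) 0 (const S.As))
    (Matrix.fromRows (const S.Bu + S.RD X) (const S.Bs))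
    (Matrix.fromCols (const (P * S.Cu)) (const (P * S.Cs)))
    (const (P * S.D)))ᵀ

/-- `Q₁ = [A_u + R_u | (1 - z) M; P C_u | P]ᵀ`. -/
def Q₁ (X : Matrix (Fin nu) (Fin nu) ℂ) (P : Matrix (Fin m) (Fin m) ℂ) :
    RatMatrix (Fin m) (Fin m) :=
  (transfer (const S.Au + S.Ru X) (S.zM X) (const (P * S.Cu)) (const P))ᵀ

end BlockSystem

end LowRankSpectral

end

/-! Since `Φ` and `Φ₁₁` both have rank `m`, the Schur complement vanishes and `Φ = K K^*` with `K =
[G₁; H G₁]`. Any other factor with `m` columns has an invertible top block `W₁`, and it equals `K Q`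
with the para-unitary matrix `Q = G₁⁻¹ W₁`. The question is which `Q` make `K Q` minimum-phase.

The unwanted poles of `T = G₁ᵀ Hᵀ` come from `A_u`. The injection `(1 - z) M` multiplies `T` from
the left by a matrix `q`, and `Q₁ = (P q)ᵀ`, `W₂ = (P q T)ᵀ`. In the variable `w = 1/z` the
resolvents become inverses of polynomial pencils, and `z = ∞` is the ordinary point `w = 0`. The
Stein equation factors the unstable pencil as `X⁻¹ (w - A_u^*)` times a constant invertible matrix
(`stein_pencil`), which is invertible for `|w| ≤ 1`. It also gives `q q^* = 1`
(`IsAdmissible.q_mul_paraStar`). `X` is invertible because a minimal realization is observable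
(`isUnit_of_stein`).

Outside the closed disc, controllability makes `(q, q T)` left coprime (`IsAdmissible.coprime`). As
`G₁` has no zeros there, neither has `K Q₁`. On the circle poles are excluded because `W W^* = Φ`
has none (`regular_of_mul_paraStar`).

If two minimum-phase matrices differ by a para-unitary `U`, then `U` and `U^*` are regular outside
the closed disc, hence by reflection `U` is regular inside, and `U U^* = 1` excludes poles on the
circle. So `U` has no poles and is constant (`exists_unitary_of_isMinimumPhase`). This gives the
parametrization by `P`. The normalization `q(1) = 1` makes the choice independent of the
realization. -/

noncomputable section

namespace LowRankSpectral

/-! ### Substitution homomorphisms -/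

/-- Substitution of `y` for the variable, as a ring homomorphism. -/
def evalHom (f : ℂ →+* RatFunc ℂ) (y : RatFunc ℂ)
    (h : ∀ p : Polynomial ℂ, p ≠ 0 → p.eval₂ f y ≠ 0) : RatFunc ℂ →+* RatFunc ℂ where
  toFun := RatFunc.eval f y
  map_one' := RatFunc.eval_one _ _
  map_zero' := RatFunc.eval_zero _ _
  map_mul' _ _ := RatFunc.eval_mul _ _ (h _ (RatFunc.denom_ne_zero _))
    (h _ (RatFunc.denom_ne_zero _))
  map_add' _ _ := RatFunc.eval_add _ _ (h _ (RatFunc.denom_ne_zero _))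
    (h _ (RatFunc.denom_ne_zero _))

theorem ringHom_ext_C_X {f g : RatFunc ℂ →+* RatFunc ℂ}
    (hC : ∀ c, f (RatFunc.C c) = g (RatFunc.C c)) (hX : f RatFunc.X = g RatFunc.X) : f = g := by
  refine IsLocalization.ringHom_ext (nonZeroDivisors (Polynomial ℂ)) ?_
  refine Polynomial.ringHom_ext (fun c => ?_) ?_
  · simpa using hC c
  · simpa using hX

theorem eval₂_X_ne_zero (τ : ℂ →+* ℂ) (p : Polynomial ℂ) (hp : p ≠ 0) :
    p.eval₂ ((RatFunc.C : ℂ →+* RatFunc ℂ).comp τ) RatFunc.X ≠ 0 := by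
  have : p.eval₂ ((RatFunc.C : ℂ →+* RatFunc ℂ).comp τ) RatFunc.X
      = algebraMap (Polynomial ℂ) (RatFunc ℂ) (p.map τ) := by
    rw [← RatFunc.algebraMap_X, ← RatFunc.algebraMap_comp_C, RingHom.comp_assoc,
      ← Polynomial.hom_eval₂]
    rfl
  rw [this]
  simpa [Polynomial.map_eq_zero] using hp

/-- Up to a power of `X`, substituting `X⁻¹` in a polynomial is substituting `X` in the reversed
polynomial. -/
theorem eval₂_inv_X_ne_zero (τ : ℂ →+* ℂ) (p : Polynomial ℂ) (hp : p ≠ 0) :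
    p.eval₂ ((RatFunc.C : ℂ →+* RatFunc ℂ).comp τ) (RatFunc.X)⁻¹ ≠ 0 := by
  have hX : (RatFunc.X : RatFunc ℂ)⁻¹ ≠ 0 := inv_ne_zero RatFunc.X_ne_zero
  let _ := invertibleOfNonzero hX
  have h := Polynomial.eval₂_reverse_mul_pow ((RatFunc.C : ℂ →+* RatFunc ℂ).comp τ)
    (RatFunc.X)⁻¹ p
  rw [invOf_eq_inv, inv_inv] at h
  rw [← h]
  exact mul_ne_zero (eval₂_X_ne_zero τ _ (by simpa using hp)) (pow_ne_zero _ hX)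

/-- `invArg` as a ring homomorphism. -/
def invArgHom : RatFunc ℂ →+* RatFunc ℂ :=
  evalHom (RatFunc.C.comp (RingHom.id ℂ)) (RatFunc.X)⁻¹ (eval₂_inv_X_ne_zero _)

/-- `paraConj` as a ring homomorphism. -/
def paraConjHom : RatFunc ℂ →+* RatFunc ℂ :=
  evalHom (RatFunc.C.comp (starRingEnd ℂ)) (RatFunc.X)⁻¹ (eval₂_inv_X_ne_zero _)

/-- Conjugation of the coefficients. -/
def coeffConjHom : RatFunc ℂ →+* RatFunc ℂ :=
  evalHom (RatFunc.C.comp (starRingEnd ℂ)) RatFunc.X (eval₂_X_ne_zero _)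

@[simp] theorem evalHom_C (f : ℂ →+* RatFunc ℂ) (y h) (c : ℂ) :
    evalHom f y h (RatFunc.C c) = f c := RatFunc.eval_C _ _

@[simp] theorem evalHom_X (f : ℂ →+* RatFunc ℂ) (y h) :
    evalHom f y h RatFunc.X = y := RatFunc.eval_X _ _

theorem paraConjHom_apply (r : RatFunc ℂ) : paraConjHom r = paraConj r := rfl

@[simp] theorem paraConj_C (c : ℂ) : paraConj (RatFunc.C c) = RatFunc.C (star c) := by
  simp [← paraConjHom_apply, paraConjHom]

@[simp] theorem paraConj_X : paraConj RatFunc.X = (RatFunc.X)⁻¹ := by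
  simp [← paraConjHom_apply, paraConjHom]

theorem paraConj_paraConj (r : RatFunc ℂ) : paraConj (paraConj r) = r := by
  have : paraConjHom.comp paraConjHom = RingHom.id _ :=
    ringHom_ext_C_X (fun c => by simp [paraConjHom]) (by simp [paraConjHom])
  exact RingHom.congr_fun this r

theorem coeffConjHom_invArgHom (r : RatFunc ℂ) :
    coeffConjHom (invArgHom r) = paraConjHom r := by
  have : coeffConjHom.comp invArgHom = paraConjHom :=
    ringHom_ext_C_X (fun c => by simp [paraConjHom, coeffConjHom, invArgHom])
      (by simp [paraConjHom, coeffConjHom, invArgHom])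
  exact RingHom.congr_fun this r

/-! ### Rational functions regular at a point of the sphere -/

theorem denom_eval_ne_zero_of_dvd {r : RatFunc ℂ} {q : Polynomial ℂ} {a : ℂ}
    (h : r.denom ∣ q) (hq : q.eval a ≠ 0) : r.denom.eval a ≠ 0 := fun h0 =>
  hq (Polynomial.eval_eq_zero_of_dvd_of_eval_eq_zero h h0)

/-- The local ring of the rational functions without a pole at `a`. -/
def regularAtCoe (a : ℂ) : ValuationSubring (RatFunc ℂ) where
  carrier := {r | r.denom.eval a ≠ 0}
  mul_mem' {x y} hx hy := denom_eval_ne_zero_of_dvd (RatFunc.denom_mul_dvd x y)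
    (by rw [Polynomial.eval_mul]; exact mul_ne_zero hx hy)
  add_mem' {x y} hx hy := denom_eval_ne_zero_of_dvd (RatFunc.denom_add_dvd x y)
    (by rw [Polynomial.eval_mul]; exact mul_ne_zero hx hy)
  one_mem' := by simp
  zero_mem' := by simp
  neg_mem' {x} hx := by
    have : -x = RatFunc.C (-1) * x := by simp
    rw [this]
    refine denom_eval_ne_zero_of_dvd (RatFunc.denom_mul_dvd _ x) ?_
    rw [RatFunc.denom_C, one_mul]
    exact hx
  mem_or_inv_mem' x := by
    by_cases hx : x.denom.eval a = 0
    · right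
      have hx0 : x ≠ 0 := by rintro rfl; simp at hx
      refine denom_eval_ne_zero_of_dvd (RatFunc.denom_inv_dvd hx0) fun hn => ?_
      obtain ⟨u, v, huv⟩ := RatFunc.isCoprime_num_denom x
      have := congrArg (Polynomial.eval a) huv
      simp [hn, hx] at this
    · exact Or.inl hx

/-- The value at `a` of the functions regular at `a`. -/
def valueHomCoe (a : ℂ) : regularAtCoe a →+* ℂ where
  toFun r := (r : RatFunc ℂ).eval (RingHom.id ℂ) a
  map_one' := RatFunc.eval_one _ _
  map_zero' := RatFunc.eval_zero _ _
  map_mul' x y := RatFunc.eval_mul _ _ x.2 y.2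
  map_add' x y := RatFunc.eval_add _ _ x.2 y.2

/-- The local ring of the rational functions without a pole at `α`. -/
def regularAt : OnePoint ℂ → ValuationSubring (RatFunc ℂ)
  | ∞ => (regularAtCoe 0).comap invArgHom
  | (z : ℂ) => regularAtCoe z

/-- The value at `α` of the functions regular at `α`. -/
def valueHom : (α : OnePoint ℂ) → regularAt α →+* ℂ
  | ∞ => (valueHomCoe 0).comp
      ((invArgHom.comp (regularAt ∞).subtype).codRestrict (regularAtCoe 0).toSubring
        fun x => x.2)
  | (z : ℂ) => valueHomCoe z

theorem mem_regularAt {α : OnePoint ℂ} {r : RatFunc ℂ} : r ∈ regularAt α ↔ ¬ IsPole r α := by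
  cases α <;> rfl

theorem valueHom_apply {α : OnePoint ℂ} (r : regularAt α) :
    valueHom α r = value (r : RatFunc ℂ) α := by
  cases α <;> rfl

theorem C_mem_regularAt (α : OnePoint ℂ) (c : ℂ) : RatFunc.C c ∈ regularAt α := by
  cases α with
  | infty =>
    change (invArgHom (RatFunc.C c)).denom.eval 0 ≠ 0
    simp [invArgHom]
  | coe z =>
    change (RatFunc.C c).denom.eval z ≠ 0
    simp

theorem value_C (α : OnePoint ℂ) (c : ℂ) : value (RatFunc.C c) α = c := by
  cases α with
  | infty =>
    change (invArgHom (RatFunc.C c)).eval _ 0 = c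
    simp [invArgHom]
  | coe z =>
    change (RatFunc.C c).eval _ z = c
    simp

/-- Constants, as functions regular at `α`. -/
def regularC (α : OnePoint ℂ) : ℂ →+* regularAt α :=
  RatFunc.C.codRestrict (regularAt α).toSubring (C_mem_regularAt α)

@[simp] theorem valueHom_regularC (α : OnePoint ℂ) (c : ℂ) : valueHom α (regularC α c) = c := by
  rw [valueHom_apply]
  exact value_C α c

/-- A surjection from a local ring is local. Hence a function, or a square matrix, with invertible
value at `α` has an inverse regular at `α`. -/
instance (α : OnePoint ℂ) : IsLocalHom (valueHom α) :=
  IsLocalHom.of_surjective _ fun c => ⟨regularC α c, valueHom_regularC α c⟩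

theorem inv_mem_regularAt {α : OnePoint ℂ} {r : RatFunc ℂ} (h : r ∈ regularAt α)
    (hv : value r α ≠ 0) : r⁻¹ ∈ regularAt α := by
  have hu : IsUnit (⟨r, h⟩ : regularAt α) :=
    isUnit_of_map_unit (valueHom α) _ (by rw [valueHom_apply]; exact hv.isUnit)
  obtain ⟨s, hs⟩ := hu.exists_right_inv
  have : r * s = 1 := congrArg Subtype.val hs
  rw [← eq_inv_of_mul_eq_one_right this]
  exact s.2

theorem value_mul {α : OnePoint ℂ} {r s : RatFunc ℂ} (hr : r ∈ regularAt α)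
    (hs : s ∈ regularAt α) : value (r * s) α = value r α * value s α := by
  simpa [valueHom_apply] using (valueHom α).map_mul ⟨r, hr⟩ ⟨s, hs⟩

theorem value_one (α : OnePoint ℂ) : value 1 α = 1 := by
  simpa [valueHom_apply] using (valueHom α).map_one

theorem value_inv_eq_zero {α : OnePoint ℂ} {r : RatFunc ℂ} (h : r ∉ regularAt α) :
    r⁻¹ ∈ regularAt α ∧ value r⁻¹ α = 0 := by
  have hi := ((regularAt α).mem_or_inv_mem r).resolve_left h
  refine ⟨hi, by_contra fun hv => h ?_⟩
  simpa using inv_mem_regularAt hi hv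

/-- Regularity pulls back along a substitution whose value at `α` is `τ a`. Taking `τ` to be
conjugation gives the reflection in the unit circle. -/
theorem evalHom_regular {τ : ℂ →+* ℂ} {y : RatFunc ℂ}
    (h : ∀ p : Polynomial ℂ, p ≠ 0 → p.eval₂ ((RatFunc.C : ℂ →+* RatFunc ℂ).comp τ) y ≠ 0)
    {α : OnePoint ℂ} (hy : y ∈ regularAt α) {a : ℂ} (ha : value y α = τ a) {r : RatFunc ℂ}
    (hr : r ∈ regularAt (a : OnePoint ℂ)) :
    evalHom (RatFunc.C.comp τ) y h r ∈ regularAt α ∧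
      value (evalHom (RatFunc.C.comp τ) y h r) α = τ (value r a) := by
  have key (p : Polynomial ℂ) : p.eval₂ ((RatFunc.C : ℂ →+* RatFunc ℂ).comp τ) y ∈ regularAt α ∧
      value (p.eval₂ ((RatFunc.C : ℂ →+* RatFunc ℂ).comp τ) y) α = τ (p.eval a) := by
    have e : p.eval₂ ((RatFunc.C : ℂ →+* RatFunc ℂ).comp τ) y
        = (p.eval₂ ((regularC α).comp τ) (⟨y, hy⟩ : regularAt α) : regularAt α) := by
      have := Polynomial.hom_eval₂ p ((regularC α).comp τ) (regularAt α).subtype ⟨y, hy⟩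
      exact this.symm
    rw [e]
    refine ⟨Subtype.prop _, ?_⟩
    rw [← valueHom_apply, Polynomial.hom_eval₂, valueHom_apply]
    have : (valueHom α).comp ((regularC α).comp τ) = τ := by ext; simp
    rw [this, Polynomial.eval, Polynomial.hom_eval₂]
    simp [ha]
  have hd : r.denom.eval a ≠ 0 := hr
  have hτ : τ (r.denom.eval a) ≠ 0 := by simpa using hd
  have hden := key r.denom
  have hnum := key r.num
  have hinv := inv_mem_regularAt hden.1 (by rw [hden.2]; exact hτ)
  have e : evalHom (RatFunc.C.comp τ) y h r
      = r.num.eval₂ (RatFunc.C.comp τ) y * (r.denom.eval₂ (RatFunc.C.comp τ) y)⁻¹ :=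
    div_eq_mul_inv _ _
  refine ⟨e ▸ mul_mem hnum.1 hinv, ?_⟩
  have hv : value (r.denom.eval₂ (RatFunc.C.comp τ) y)⁻¹ α = (τ (r.denom.eval a))⁻¹ := by
    refine eq_inv_of_mul_eq_one_right ?_
    rw [← hden.2, ← value_mul hden.1 hinv, mul_inv_cancel₀ (h _ (RatFunc.denom_ne_zero r)),
      value_one]
  rw [e, value_mul hnum.1 hinv, hv, hnum.2, ← div_eq_mul_inv, ← map_div₀]
  rfl

theorem X_mem_regularAt (a : ℂ) : RatFunc.X ∈ regularAt (a : OnePoint ℂ) ∧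
    value RatFunc.X (a : OnePoint ℂ) = a := by
  constructor
  · change (RatFunc.X : RatFunc ℂ).denom.eval a ≠ 0
    simp
  · change (RatFunc.X : RatFunc ℂ).eval _ a = a
    simp

theorem inv_X_mem_regularAt {a : ℂ} (ha : a ≠ 0) :
    (RatFunc.X)⁻¹ ∈ regularAt (a : OnePoint ℂ) ∧
      value (RatFunc.X)⁻¹ (a : OnePoint ℂ) = a⁻¹ := by
  have hX := X_mem_regularAt a
  have hi := inv_mem_regularAt hX.1 (by rwa [hX.2])
  refine ⟨hi, eq_inv_of_mul_eq_one_right ?_⟩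
  nth_rw 1 [← hX.2]
  rw [← value_mul hX.1 hi, mul_inv_cancel₀ RatFunc.X_ne_zero, value_one]

theorem inv_X_mem_regularAt_infty :
    (RatFunc.X)⁻¹ ∈ regularAt ∞ ∧ value (RatFunc.X)⁻¹ ∞ = 0 := by
  have e : invArgHom (RatFunc.X)⁻¹ = RatFunc.X := by simp [invArgHom]
  constructor
  · change (invArgHom (RatFunc.X)⁻¹).denom.eval 0 ≠ 0
    simp [e]
  · change (invArgHom (RatFunc.X)⁻¹).eval _ 0 = 0
    simp [e]

/-- The function `1 / z` is regular outside the open disc, with values in the closed disc. -/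
theorem inv_X_regular_of_notMem_openDisc {α : OnePoint ℂ} (h : α ∉ openDisc) :
    (RatFunc.X)⁻¹ ∈ regularAt α ∧ ‖value (RatFunc.X)⁻¹ α‖ ≤ 1 := by
  cases α with
  | infty => simpa [inv_X_mem_regularAt_infty.2] using inv_X_mem_regularAt_infty.1
  | coe z =>
    have hz : 1 ≤ ‖z‖ := by
      by_contra hlt
      exact h ⟨z, by simpa using hlt, rfl⟩
    have hz0 : z ≠ 0 := by rintro rfl; norm_num at hz
    obtain ⟨h1, h2⟩ := inv_X_mem_regularAt hz0
    refine ⟨h1, ?_⟩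
    rw [h2, norm_inv]
    exact inv_le_one_of_one_le₀ hz

/-- The function `1 / z` is regular outside the closed disc, with values in the open disc. -/
theorem inv_X_regular_of_notMem_closedDisc {α : OnePoint ℂ} (h : α ∉ closedDisc) :
    (RatFunc.X)⁻¹ ∈ regularAt α ∧ ‖value (RatFunc.X)⁻¹ α‖ < 1 := by
  cases α with
  | infty => simpa [inv_X_mem_regularAt_infty.2] using inv_X_mem_regularAt_infty.1
  | coe z =>
    have hz : 1 < ‖z‖ := by
      by_contra hlt
      exact h ⟨z, by simpa using hlt, rfl⟩
    have hz0 : z ≠ 0 := by rintro rfl; norm_num at hz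
    obtain ⟨h1, h2⟩ := inv_X_mem_regularAt hz0
    refine ⟨h1, ?_⟩
    rw [h2, norm_inv]
    exact inv_lt_one_of_one_lt₀ hz

theorem paraConj_regular_circle {z : ℂ} (hz : ‖z‖ = 1) {r : RatFunc ℂ}
    (hr : r ∈ regularAt (z : OnePoint ℂ)) :
    paraConj r ∈ regularAt (z : OnePoint ℂ) ∧
      value (paraConj r) (z : OnePoint ℂ) = star (value r (z : OnePoint ℂ)) := by
  have hz0 : z ≠ 0 := by rintro rfl; norm_num at hz
  obtain ⟨h1, h2⟩ := inv_X_mem_regularAt hz0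
  refine evalHom_regular (τ := starRingEnd ℂ) (eval₂_inv_X_ne_zero _) h1 ?_ hr
  rw [h2, Complex.inv_eq_conj hz]

theorem paraConj_regular_openDisc {r : RatFunc ℂ}
    (hr : ∀ α ∉ closedDisc, r ∈ regularAt α) {z : ℂ} (hz : ‖z‖ < 1) :
    paraConj r ∈ regularAt (z : OnePoint ℂ) := by
  -- The mirror image of `0` is `∞`, which is reached by first passing to `invArg` and then
  -- conjugating coefficients.
  by_cases hz0 : z = 0
  · subst hz0
    have h0 : invArgHom r ∈ regularAt ((0 : ℂ) : OnePoint ℂ) :=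
      hr ∞ (by rintro ⟨z, -, h⟩; exact absurd h (OnePoint.coe_ne_infty z))
    obtain ⟨h1, h2⟩ := X_mem_regularAt 0
    rw [← paraConjHom_apply, ← coeffConjHom_invArgHom]
    exact (evalHom_regular (τ := starRingEnd ℂ) (eval₂_X_ne_zero _) h1
      (by rw [h2, map_zero]) h0).1
  · obtain ⟨h1, h2⟩ := inv_X_mem_regularAt hz0
    refine (evalHom_regular (τ := starRingEnd ℂ) (eval₂_inv_X_ne_zero _) h1
      (a := (starRingEnd ℂ) z⁻¹) (by rw [h2, starRingEnd_self_apply]) (hr _ ?_)).1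
    rintro ⟨y, hy, h⟩
    rw [OnePoint.coe_eq_coe] at h
    subst h
    simp only [Metric.mem_closedBall, dist_zero_right, RCLike.norm_conj, norm_inv] at hy
    exact absurd hy (not_le.mpr (one_lt_inv₀ (norm_pos_iff.mpr hz0) |>.mpr hz))

/-- A rational function without poles on the sphere is constant. -/
theorem exists_eq_C_of_forall_regular {r : RatFunc ℂ} (hr : ∀ α, r ∈ regularAt α) :
    ∃ c, r = RatFunc.C c := by
  have hd : r.denom = 1 := by
    refine Polynomial.eq_one_of_monic_natDegree_zero (RatFunc.monic_denom r) ?_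
    by_contra hne
    obtain ⟨z, hz⟩ := IsAlgClosed.exists_root r.denom
      (fun h => hne (Polynomial.natDegree_eq_of_degree_eq_some h))
    exact hr (z : OnePoint ℂ) hz
  have hrp : r = algebraMap (Polynomial ℂ) (RatFunc ℂ) r.num := by
    conv_lhs => rw [← RatFunc.num_div_denom r, hd]
    simp
  by_cases h0 : r.num.natDegree = 0
  · refine ⟨r.num.coeff 0, ?_⟩
    rw [← RatFunc.algebraMap_C, ← Polynomial.eq_C_of_natDegree_eq_zero h0]
    exact hrp
  -- A nonconstant polynomial of degree `k` satisfies `reverse = r(1/X) * X ^ k`. Regularity at `∞`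
  -- makes the right side vanish at `0`, where the left side is the leading coefficient.
  · exfalso
    obtain ⟨hX, hX'⟩ := X_mem_regularAt 0
    have hi : invArgHom r ∈ regularAt ((0 : ℂ) : OnePoint ℂ) := hr ∞
    have hXi : (RatFunc.X : RatFunc ℂ)⁻¹ ≠ 0 := inv_ne_zero RatFunc.X_ne_zero
    let _ := invertibleOfNonzero hXi
    have h := Polynomial.eval₂_reverse_mul_pow
      ((RatFunc.C : ℂ →+* RatFunc ℂ).comp (RingHom.id ℂ)) (RatFunc.X)⁻¹ r.num
    rw [invOf_eq_inv, inv_inv] at h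
    have e1 : r.num.eval₂ ((RatFunc.C : ℂ →+* RatFunc ℂ).comp (RingHom.id ℂ)) (RatFunc.X)⁻¹
        = invArgHom r := by
      change _ = RatFunc.eval _ _ r
      rw [RatFunc.eval, hd, Polynomial.eval₂_one, div_one]
    have e2 : r.num.reverse.eval₂ ((RatFunc.C : ℂ →+* RatFunc ℂ).comp (RingHom.id ℂ)) RatFunc.X
        = algebraMap (Polynomial ℂ) (RatFunc ℂ) r.num.reverse := by
      rw [← RatFunc.algebraMap_X, RingHom.comp_id, ← RatFunc.algebraMap_comp_C,
        ← Polynomial.hom_eval₂]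
      simp
    rw [e1, e2, inv_pow, mul_inv_eq_iff_eq_mul₀ (pow_ne_zero _ RatFunc.X_ne_zero)] at h
    obtain ⟨k, hk⟩ := Nat.exists_eq_succ_of_ne_zero h0
    have hv := congrArg (fun s => value s ((0 : ℂ) : OnePoint ℂ)) h
    simp only [hk, pow_succ] at hv
    rw [value_mul hi (mul_mem (pow_mem hX _) hX), value_mul (pow_mem hX _) hX, hX', mul_zero,
      mul_zero] at hv
    have : value (algebraMap (Polynomial ℂ) (RatFunc ℂ) r.num.reverse) ((0 : ℂ) : OnePoint ℂ)
        = r.num.reverse.eval 0 := by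
      change RatFunc.eval _ _ _ = _
      rw [RatFunc.eval_algebraMap]
      rfl
    rw [this, ← Polynomial.coeff_zero_eq_eval_zero, Polynomial.coeff_zero_reverse,
      Polynomial.leadingCoeff_eq_zero] at hv
    rw [hv] at h0
    simp at h0

/-! ### Values of rational matrices -/

/-- `W` is regular at `α`, with value `V`. -/
def HasValue {a b : Type} (W : RatMatrix a b) (α : OnePoint ℂ) (V : Matrix a b ℂ) : Prop :=
  (∀ i j, W i j ∈ regularAt α) ∧ matValue W α = V

section

variable {a b c d : Type} {α : OnePoint ℂ}

theorem not_isMatPole_iff {W : RatMatrix a b} :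
    ¬ IsMatPole W α ↔ ∀ i j, W i j ∈ regularAt α := by
  simp [IsMatPole, mem_regularAt]

theorem isStable_iff {W : RatMatrix a b} :
    IsStable W ↔ ∀ α ∉ openDisc, ∀ i j, W i j ∈ regularAt α := by
  refine forall_congr' fun α => ?_
  rw [← not_imp_not, not_isMatPole_iff]

/-- The matrix over the local ring at `α` given by a regular rational matrix. -/
def localMat (W : RatMatrix a b) (h : ∀ i j, W i j ∈ regularAt α) :
    Matrix a b (regularAt α) := Matrix.of fun i j => ⟨W i j, h i j⟩

theorem hasValue_map (W' : Matrix a b (regularAt α)) :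
    HasValue (W'.map (regularAt α).subtype) α (W'.map (valueHom α)) := by
  refine ⟨fun i j => (W' i j).2, ?_⟩
  ext i j
  exact (valueHom_apply _).symm

theorem HasValue.exists_local {W : RatMatrix a b} {V : Matrix a b ℂ} (h : HasValue W α V) :
    ∃ W' : Matrix a b (regularAt α),
      W = W'.map (regularAt α).subtype ∧ V = W'.map (valueHom α) := by
  refine ⟨localMat W h.1, rfl, h.2.symm.trans ?_⟩
  ext i j
  exact (valueHom_apply (⟨W i j, h.1 i j⟩ : regularAt α)).symm

theorem hasValue_const (A : Matrix a b ℂ) : HasValue (const A) α A := by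
  refine ⟨fun i j => C_mem_regularAt α _, ?_⟩
  ext i j
  exact value_C α _

theorem HasValue.mul [Fintype b] {W : RatMatrix a b} {W₂ : RatMatrix b c} {V V₂}
    (h : HasValue W α V) (h₂ : HasValue W₂ α V₂) : HasValue (W * W₂) α (V * V₂) := by
  obtain ⟨W', rfl, rfl⟩ := h.exists_local
  obtain ⟨W₂', rfl, rfl⟩ := h₂.exists_local
  rw [← Matrix.map_mul, ← Matrix.map_mul]
  exact hasValue_map _

theorem HasValue.add {W W₂ : RatMatrix a b} {V V₂}
    (h : HasValue W α V) (h₂ : HasValue W₂ α V₂) : HasValue (W + W₂) α (V + V₂) := by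
  obtain ⟨W', rfl, rfl⟩ := h.exists_local
  obtain ⟨W₂', rfl, rfl⟩ := h₂.exists_local
  rw [← Matrix.map_add _ (map_add _), ← Matrix.map_add _ (map_add _)]
  exact hasValue_map _

theorem HasValue.sub {W W₂ : RatMatrix a b} {V V₂}
    (h : HasValue W α V) (h₂ : HasValue W₂ α V₂) : HasValue (W - W₂) α (V - V₂) := by
  obtain ⟨W', rfl, rfl⟩ := h.exists_local
  obtain ⟨W₂', rfl, rfl⟩ := h₂.exists_local
  rw [← Matrix.map_sub _ (map_sub _), ← Matrix.map_sub _ (map_sub _)]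
  exact hasValue_map _

theorem HasValue.smul {r : RatFunc ℂ} (hr : r ∈ regularAt α) {W : RatMatrix a b} {V}
    (h : HasValue W α V) : HasValue (r • W) α (value r α • V) := by
  refine ⟨fun i j => mul_mem hr (h.1 i j), ?_⟩
  rw [← h.2]
  ext i j
  exact value_mul hr (h.1 i j)

theorem hasValue_one [DecidableEq a] : HasValue (1 : RatMatrix a a) α 1 := by
  convert hasValue_const (α := α) (1 : Matrix a a ℂ)
  simp [const]

theorem HasValue.transpose {W : RatMatrix a b} {V} (h : HasValue W α V) :
    HasValue Wᵀ α Vᵀ := by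
  obtain ⟨W', rfl, rfl⟩ := h.exists_local
  exact hasValue_map W'ᵀ

theorem HasValue.fromBlocks {A : RatMatrix a c} {B : RatMatrix a d} {C : RatMatrix b c}
    {D : RatMatrix b d} {A' B' C' D'} (hA : HasValue A α A') (hB : HasValue B α B')
    (hC : HasValue C α C') (hD : HasValue D α D') :
    HasValue (Matrix.fromBlocks A B C D) α (Matrix.fromBlocks A' B' C' D') := by
  obtain ⟨A, rfl, rfl⟩ := hA.exists_local
  obtain ⟨B, rfl, rfl⟩ := hB.exists_local
  obtain ⟨C, rfl, rfl⟩ := hC.exists_local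
  obtain ⟨D, rfl, rfl⟩ := hD.exists_local
  rw [← Matrix.fromBlocks_map, ← Matrix.fromBlocks_map]
  exact hasValue_map _

theorem HasValue.fromRows {A : RatMatrix a c} {B : RatMatrix b c} {A' B'}
    (hA : HasValue A α A') (hB : HasValue B α B') :
    HasValue (Matrix.fromRows A B) α (Matrix.fromRows A' B') := by
  refine ⟨?_, ?_⟩
  · rintro (i | i) j
    exacts [hA.1 i j, hB.1 i j]
  · rw [← hA.2, ← hB.2]
    ext (i | i) j <;> rfl

theorem HasValue.inv [Fintype a] [DecidableEq a] {N : RatMatrix a a} {V}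
    (h : HasValue N α V) (hV : IsUnit V) : IsUnit N ∧ HasValue N⁻¹ α V⁻¹ := by
  obtain ⟨N', rfl, rfl⟩ := h.exists_local
  have hu : IsUnit N' := by
    rw [Matrix.isUnit_iff_isUnit_det] at hV ⊢
    rw [← RingHom.mapMatrix_apply, ← RingHom.map_det] at hV
    exact isUnit_of_map_unit _ _ hV
  obtain ⟨M', hM⟩ := hu.exists_right_inv
  have h1 : N'.map (regularAt α).subtype * M'.map (regularAt α).subtype = 1 := by
    rw [← Matrix.map_mul, hM, Matrix.map_one _ (map_zero _) (map_one _)]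
  have h2 : N'.map (valueHom α) * M'.map (valueHom α) = 1 := by
    rw [← Matrix.map_mul, hM, Matrix.map_one _ (map_zero _) (map_one _)]
  refine ⟨IsUnit.of_mul_eq_one _ h1, ?_⟩
  rw [Matrix.inv_eq_right_inv h1, Matrix.inv_eq_right_inv h2]
  exact hasValue_map _

end

/-! ### Para-conjugate transpose -/

section

variable {a b c : Type}

theorem paraConj_mul (r s : RatFunc ℂ) : paraConj (r * s) = paraConj r * paraConj s :=
  map_mul paraConjHom r s

theorem paraStar_eq (W : RatMatrix a b) : paraStar W = (W.map paraConjHom)ᵀ := rfl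

theorem paraStar_mul [Fintype b] (V : RatMatrix a b) (W : RatMatrix b c) :
    paraStar (V * W) = paraStar W * paraStar V := by
  simp only [paraStar_eq, Matrix.map_mul, Matrix.transpose_mul]

theorem paraStar_one [DecidableEq a] : paraStar (1 : RatMatrix a a) = 1 := by
  rw [paraStar_eq, Matrix.map_one _ (map_zero _) (map_one _), Matrix.transpose_one]

theorem paraStar_sub (V W : RatMatrix a b) : paraStar (V - W) = paraStar V - paraStar W := by
  rw [paraStar_eq, Matrix.map_sub _ (map_sub _), Matrix.transpose_sub]
  rfl

theorem paraStar_smul (r : RatFunc ℂ) (W : RatMatrix a b) :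
    paraStar (r • W) = paraConj r • paraStar W := by
  ext i j
  exact paraConj_mul _ _

theorem paraStar_const (A : Matrix a b ℂ) : paraStar (const A) = const Aᴴ := by
  ext i j
  exact paraConj_C _

theorem paraStar_paraStar (W : RatMatrix a b) : paraStar (paraStar W) = W := by
  ext i j
  exact paraConj_paraConj _

theorem paraStar_inv [Fintype a] [DecidableEq a] {N : RatMatrix a a} (h : IsUnit N) :
    paraStar N⁻¹ = (paraStar N)⁻¹ := by
  rw [Matrix.isUnit_iff_isUnit_det] at h
  refine (Matrix.inv_eq_left_inv ?_).symm
  rw [← paraStar_mul, Matrix.mul_nonsing_inv _ h, paraStar_one]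

theorem paraStar_fromRows (V : RatMatrix a c) (W : RatMatrix b c) :
    paraStar (Matrix.fromRows V W) = Matrix.fromCols (paraStar V) (paraStar W) := by
  ext i (j | j) <;> rfl

theorem const_mul [Fintype b] (A : Matrix a b ℂ) (B : Matrix b c ℂ) :
    const (A * B) = const A * const B := Matrix.map_mul

theorem const_one [DecidableEq a] : const (1 : Matrix a a ℂ) = 1 := by
  simp [const]

theorem const_sub (A B : Matrix a b ℂ) : const (A - B) = const A - const B :=
  Matrix.map_sub _ (map_sub _) _ _

theorem const_add (A B : Matrix a b ℂ) : const (A + B) = const A + const B :=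
  Matrix.map_add _ (map_add _) _ _

theorem const_neg (A : Matrix a b ℂ) : const (-A) = -const A := by
  ext i j
  exact map_neg RatFunc.C _

theorem const_injective : Function.Injective (const : Matrix a b ℂ → RatMatrix a b) :=
  Matrix.map_injective RatFunc.C_injective

end

/-! ### Regularity on the unit circle and at poles -/

/-- Functions not all regular at `α` can be scaled by a function vanishing at `α` so that they
become regular and one of them becomes `1`. -/
theorem exists_scaling {ι : Type} [Finite ι] {α : OnePoint ℂ} {f : ι → RatFunc ℂ}
    {i₀ : ι} (h : f i₀ ∉ regularAt α) :
    ∃ t ∈ regularAt α, value t α = 0 ∧ (∀ i, t * f i ∈ regularAt α) ∧ ∃ j, t * f j = 1 := by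
  have : Nonempty ι := ⟨i₀⟩
  -- The scaling is by the inverse of a function with the worst pole at `α`, that is, of largest
  -- valuation.
  obtain ⟨j, hj⟩ := Finite.exists_max fun i => (regularAt α).valuation (f i)
  have hjr : f j ∉ regularAt α := fun hr => h <| by
    rw [← ValuationSubring.valuation_le_one_iff] at hr ⊢
    exact (hj i₀).trans hr
  have hj0 : f j ≠ 0 := fun h0 => hjr (h0 ▸ zero_mem _)
  obtain ⟨h1, h2⟩ := value_inv_eq_zero hjr
  refine ⟨(f j)⁻¹, h1, h2, fun i => ?_, j, inv_mul_cancel₀ hj0⟩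
  rw [← ValuationSubring.valuation_le_one_iff, map_mul, map_inv₀]
  have hv : (regularAt α).valuation (f j) ≠ 0 := by simpa using hj0
  calc _ ≤ ((regularAt α).valuation (f j))⁻¹ * (regularAt α).valuation (f j) := by
        gcongr; exact hj i
    _ = 1 := inv_mul_cancel₀ hv

/-- On the circle the sum is a sum of squared moduli, so poles cannot cancel. After scaling, a pole
would give squares with sum zero, one of which is `1`. -/
theorem regular_of_sum_mul_paraConj {ι : Type} [Fintype ι] {z : ℂ} (hz : ‖z‖ = 1)
    {f : ι → RatFunc ℂ} (h : ∑ i, f i * paraConj (f i) ∈ regularAt (z : OnePoint ℂ)) (i : ι) :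
    f i ∈ regularAt (z : OnePoint ℂ) := by
  by_contra hi
  obtain ⟨t, ht, ht0, hf, j, hj⟩ := exists_scaling hi
  have hpt := (paraConj_regular_circle hz ht).1
  have e : ∑ i, (t * f i) * paraConj (t * f i)
      = t * (paraConj t * ∑ i, f i * paraConj (f i)) := by
    simp only [Finset.mul_sum, paraConj_mul]
    exact Finset.sum_congr rfl fun i _ => by ring
  have hv := congrArg (fun s => value s (z : OnePoint ℂ)) e
  rw [value_mul ht (mul_mem hpt h), ht0, zero_mul] at hv
  have hs : value (∑ i, (t * f i) * paraConj (t * f i)) (z : OnePoint ℂ)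
      = ∑ i, value (t * f i) z * star (value (t * f i) z) := by
    have e' : ∑ i, (t * f i) * paraConj (t * f i) = ((∑ i, ⟨t * f i, hf i⟩ *
        ⟨paraConj (t * f i), (paraConj_regular_circle hz (hf i)).1⟩ :
          regularAt (z : OnePoint ℂ)) : RatFunc ℂ) := by
      simp
    rw [e', ← valueHom_apply, map_sum]
    refine Finset.sum_congr rfl fun i _ => ?_
    rw [map_mul, valueHom_apply, valueHom_apply, (paraConj_regular_circle hz (hf i)).2]
  rw [hs] at hv
  have h0 := (Finset.sum_eq_zero_iff_of_nonneg fun i _ => mul_star_self_nonneg _).mp hv j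
    (Finset.mem_univ j)
  rw [hj, value_one] at h0
  simp at h0

theorem regular_of_mul_paraStar {a b : Type} [Fintype b] {W : RatMatrix a b} {z : ℂ}
    (hz : ‖z‖ = 1) (h : ∀ i j, (W * paraStar W) i j ∈ regularAt (z : OnePoint ℂ)) (i : a)
    (j : b) : W i j ∈ regularAt (z : OnePoint ℂ) :=
  regular_of_sum_mul_paraConj hz (f := W i) (h i i) j

theorem mem_or_of_notMem_openDisc {α : OnePoint ℂ} (h : α ∉ openDisc) :
    α ∉ closedDisc ∨ ∃ z : ℂ, ‖z‖ = 1 ∧ α = z := by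
  by_contra! hc
  obtain ⟨z, hz, rfl⟩ := hc.1
  simp only [Metric.mem_closedBall, dist_zero_right] at hz
  rcases hz.lt_or_eq with hz | hz
  · exact h ⟨z, by simpa using hz, rfl⟩
  · exact hc.2 z hz rfl

theorem notMem_openDisc_of_notMem_closedDisc {α : OnePoint ℂ} (h : α ∉ closedDisc) :
    α ∉ openDisc := fun ⟨z, hz, e⟩ => h ⟨z, Metric.ball_subset_closedBall hz, e⟩

theorem IsMinimumPhase.regular {a b : Type} [Fintype b] {W : RatMatrix a b}
    (h : IsMinimumPhase W) {α : OnePoint ℂ} (hα : α ∉ openDisc) (i : a) (j : b) :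
    W i j ∈ regularAt α := isStable_iff.mp h.1 α hα i j

theorem IsMinimumPhase.hasValue {a b : Type} [Fintype b] {W : RatMatrix a b}
    (h : IsMinimumPhase W) {α : OnePoint ℂ} (hα : α ∉ openDisc) :
    HasValue W α (matValue W α) := ⟨h.regular hα, rfl⟩

theorem IsMinimumPhase.eq_zero {a b : Type} [Fintype b] {W : RatMatrix a b}
    (h : IsMinimumPhase W) {α : OnePoint ℂ} (hα : α ∉ closedDisc) {v : b → ℂ}
    (hv : matValue W α *ᵥ v = 0) : v = 0 := by
  by_contra hne
  exact hα (h.2 α ⟨not_isMatPole_iff.mpr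
    (h.regular (notMem_openDisc_of_notMem_closedDisc hα)), v, hne, hv⟩)

/-- If `U` had a pole, a scaled copy would be regular with a nonzero column at `α`. That column
would lie in the kernel of `V(α)`, which is trivial outside the closed disc. -/
theorem IsMinimumPhase.regular_of_mul {a b c : Type} [Fintype b] [Finite c] {V : RatMatrix a b}
    (hV : IsMinimumPhase V) {U : RatMatrix b c} {α : OnePoint ℂ}
    (hα : α ∉ closedDisc) (h : ∀ i j, (V * U) i j ∈ regularAt α) (i : b) (j : c) :
    U i j ∈ regularAt α := by
  by_contra hU
  obtain ⟨t, ht, ht0, hf, ⟨k, l⟩, hkl⟩ :=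
    exists_scaling (f := fun x : b × c => U x.1 x.2) (i₀ := (i, j)) hU
  have hα' := notMem_openDisc_of_notMem_closedDisc hα
  have h1 : HasValue (t • U) α (matValue (t • U) α) := ⟨fun i j => hf (i, j), rfl⟩
  have h2 := (hV.hasValue hα').mul h1
  have h3 : HasValue (t • (V * U)) α (value t α • matValue (V * U) α) :=
    HasValue.smul ht ⟨h, rfl⟩
  rw [Matrix.mul_smul] at h2
  have h4 : matValue V α * matValue (t • U) α = 0 := by
    rw [← h2.2, h3.2, ht0, zero_smul]
  have h5 : (matValue (t • U) α).col l = 0 := by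
    refine hV.eq_zero hα ?_
    ext x
    exact congrFun (congrFun h4 x) l
  have h6 := congrFun h5 k
  have h7 : value (t * U k l) α = 0 := h6
  rw [hkl, value_one] at h7
  exact one_ne_zero h7

/-- Two minimum-phase matrices that differ by a para-unitary factor differ by a constant one. -/
theorem exists_unitary_of_isMinimumPhase {a b : Type} [Fintype b] [DecidableEq b]
    {V W : RatMatrix a b} (hV : IsMinimumPhase V) (hW : IsMinimumPhase W) {U : RatMatrix b b}
    (hU : U * paraStar U = 1) (h : W = V * U) :
    ∃ U₀ ∈ Matrix.unitaryGroup b ℂ, U = const U₀ := by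
  have h' : V = W * paraStar U := by rw [h, Matrix.mul_assoc, hU, Matrix.mul_one]
  have out {α : OnePoint ℂ} (hα : α ∉ closedDisc) : (∀ i j, U i j ∈ regularAt α) ∧
      ∀ i j, paraStar U i j ∈ regularAt α := by
    have hα' := notMem_openDisc_of_notMem_closedDisc hα
    exact ⟨hV.regular_of_mul hα (h ▸ hW.regular hα'),
      hW.regular_of_mul hα (h' ▸ hV.regular hα')⟩
  -- Inside the disc, regularity of `U` is that of `paraStar U` at the mirror image. On the circle
  -- it follows from `U U^* = 1`.
  have all (i j : b) (α : OnePoint ℂ) : U i j ∈ regularAt α := by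
    by_cases hα : α ∈ openDisc
    · obtain ⟨z, hz, rfl⟩ := hα
      rw [← paraConj_paraConj (U i j)]
      exact paraConj_regular_openDisc (fun β hβ => (out hβ).2 j i) (by simpa using hz)
    · rcases mem_or_of_notMem_openDisc hα with hα | ⟨z, hz, rfl⟩
      · exact (out hα).1 i j
      · refine regular_of_mul_paraStar hz (fun i j => ?_) i j
        rw [hU]
        exact hasValue_one.1 i j
  choose c hc using fun i j => exists_eq_C_of_forall_regular (all i j)
  have e : U = const (Matrix.of c) := by
    ext i j
    exact hc i j
  refine ⟨Matrix.of c, ?_, e⟩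
  rw [Matrix.mem_unitaryGroup_iff]
  apply const_injective
  rw [const_mul, const_one, Matrix.star_eq_conjTranspose, ← paraStar_const, ← e, hU]

/-! ### Eigenvectors and minimal realizations -/

section

variable {n a b : Type} [Fintype n] [DecidableEq n]

theorem isUnit_X_sub_const (A : Matrix n n ℂ) :
    IsUnit ((RatFunc.X : RatFunc ℂ) • (1 : RatMatrix n n) - const A) := by
  -- It is enough that `1 - A / z` takes the invertible value `1` at infinity.
  obtain ⟨hw, hw0⟩ := inv_X_mem_regularAt_infty
  have h : HasValue ((1 : RatMatrix n n) - (RatFunc.X : RatFunc ℂ)⁻¹ • const A) ∞ 1 := by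
    convert hasValue_one.sub (HasValue.smul hw (hasValue_const A)) using 1
    rw [hw0, zero_smul, sub_zero]
  have hu := (h.inv isUnit_one).1
  have e : (RatFunc.X : RatFunc ℂ) • (1 : RatMatrix n n) - const A
      = (RatFunc.X : RatFunc ℂ) • ((1 : RatMatrix n n) - (RatFunc.X : RatFunc ℂ)⁻¹ • const A) := by
    rw [smul_sub, smul_smul, mul_inv_cancel₀ RatFunc.X_ne_zero, one_smul]
  rw [e]
  exact hu.smul (Units.mk0 (RatFunc.X : RatFunc ℂ) RatFunc.X_ne_zero)

/-- `π` need not be square, so this covers passing to a quotient of the state space by an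
unobservable subspace. -/
theorem transfer_eq_of_intertwine {k : Type} [Fintype k] [DecidableEq k]
    {A : Matrix n n ℂ} {A' : Matrix k k ℂ} {C : Matrix a n ℂ} {C' : Matrix a k ℂ}
    {π : Matrix k n ℂ} (hA : A' * π = π * A) (hC : C' * π = C) (B : Matrix n b ℂ)
    (D : Matrix a b ℂ) :
    transfer (const A) (const B) (const C) (const D)
      = transfer (const A') (const (π * B)) (const C') (const D) := by
  have h1 := (Matrix.isUnit_iff_isUnit_det _).mp (isUnit_X_sub_const A)
  have h2 := (Matrix.isUnit_iff_isUnit_det _).mp (isUnit_X_sub_const A')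
  have h : const π * ((RatFunc.X : RatFunc ℂ) • (1 : RatMatrix n n) - const A)
      = ((RatFunc.X : RatFunc ℂ) • (1 : RatMatrix k k) - const A') * const π := by
    rw [Matrix.mul_sub, Matrix.sub_mul, ← const_mul, ← const_mul, hA]
    simp
  have h' : const π * ((RatFunc.X : RatFunc ℂ) • (1 : RatMatrix n n) - const A)⁻¹
      = ((RatFunc.X : RatFunc ℂ) • (1 : RatMatrix k k) - const A')⁻¹ * const π := by
    rw [← Matrix.nonsing_inv_mul_cancel_left _ (const π * _) h2, ← Matrix.mul_assoc _ (const π),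
      ← h, Matrix.mul_nonsing_inv_cancel_right _ _ h1]
  rw [transfer, transfer, ← hC, const_mul, const_mul, Matrix.mul_assoc (const C'), h']
  simp only [Matrix.mul_assoc]

/-- These are the coordinates on the quotient by the line of `x`: subtract the multiple of `x` that
kills a coordinate `i₀` with `x i₀ ≠ 0`, then drop that coordinate. `σ` puts a zero back in its
place. -/
theorem exists_projection {x : n → ℂ} (hx : x ≠ 0) :
    ∃ k < Fintype.card n, ∃ (π : Matrix (Fin k) n ℂ) (σ : Matrix n (Fin k) ℂ) (ξ : n → ℂ),
      π *ᵥ x = 0 ∧ σ * π = 1 - Matrix.vecMulVec x ξ := by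
  obtain ⟨i₀, hi⟩ := Function.ne_iff.mp hx
  simp only [Pi.zero_apply, ne_eq] at hi
  let e := Fintype.equivFin {j : n // j ≠ i₀}
  refine ⟨Fintype.card {j : n // j ≠ i₀}, Fintype.card_subtype_lt (x := i₀) (by simp),
    Matrix.of fun k j => (if (e.symm k : n) = j then 1 else 0)
      - (if i₀ = j then x (e.symm k) / x i₀ else 0),
    Matrix.of fun j k => if (e.symm k : n) = j then 1 else 0,
    fun j => if i₀ = j then (x i₀)⁻¹ else 0, ?_, ?_⟩
  · ext k
    simp [Matrix.mulVec, dotProduct, sub_mul, Finset.sum_sub_distrib, hi]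
  · ext i j
    simp only [Matrix.mul_apply, Matrix.of_apply, Matrix.sub_apply, Matrix.one_apply,
      Matrix.vecMulVec_apply]
    rw [← e.sum_comp]
    simp only [Equiv.symm_apply_apply]
    by_cases h : i = i₀
    · subst h
      rw [Finset.sum_eq_zero fun l _ => by rw [if_neg l.2, zero_mul]]
      by_cases hj : i = j <;> simp [hj]
      subst hj
      rw [mul_inv_cancel₀ hi, sub_self]
    · rw [Finset.sum_eq_single (⟨i, h⟩ : {j : n // j ≠ i₀})
        (fun l _ hl => by rw [if_neg (fun h' => hl (Subtype.ext h')), zero_mul])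
        (fun h' => absurd (Finset.mem_univ _) h')]
      simp [div_eq_mul_inv]

theorem IsRealization.transpose {T : RatMatrix a b} {A : Matrix n n ℂ} {B : Matrix n b ℂ}
    {C : Matrix a n ℂ} {D : Matrix a b ℂ} (h : IsRealization T A B C D) :
    IsRealization Tᵀ Aᵀ Cᵀ Bᵀ Dᵀ := by
  have e {x y : Type} (M : Matrix x y ℂ) : const Mᵀ = (const M)ᵀ := rfl
  rw [IsRealization, h, transfer, transfer]
  simp only [e, Matrix.transpose_add, Matrix.transpose_mul, Matrix.transpose_nonsing_inv,
    Matrix.transpose_sub, Matrix.transpose_smul, Matrix.transpose_one, Matrix.mul_assoc]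

theorem IsMinimalRealization.transpose {T : RatMatrix a b} {A : Matrix n n ℂ} {B : Matrix n b ℂ}
    {C : Matrix a n ℂ} {D : Matrix a b ℂ} (h : IsMinimalRealization T A B C D) :
    IsMinimalRealization Tᵀ Aᵀ Cᵀ Bᵀ Dᵀ :=
  ⟨h.1.transpose, fun k A' B' C' D' h' => h.2 k A'ᵀ C'ᵀ B'ᵀ D'ᵀ h'.transpose⟩

/-- A minimal realization is observable: no eigenvector is in the kernel of `C`. -/
theorem IsMinimalRealization.eq_zero_of_eigenvector {T : RatMatrix a b} {A : Matrix n n ℂ}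
    {B : Matrix n b ℂ} {C : Matrix a n ℂ} {D : Matrix a b ℂ} (h : IsMinimalRealization T A B C D)
    {x : n → ℂ} {μ : ℂ} (hA : A *ᵥ x = μ • x) (hC : C *ᵥ x = 0) : x = 0 := by
  by_contra hx
  obtain ⟨k, hk, π, σ, ξ, hπ, hσ⟩ := exists_projection hx
  -- An unobservable eigenvector could be divided out, leaving a realization of smaller dimension.
  refine absurd (h.2 k (π * A * σ) (π * B) (C * σ) D ?_) (not_le.mpr hk)
  rw [IsRealization, h.1]
  refine transfer_eq_of_intertwine ?_ ?_ B D
  · rw [Matrix.mul_assoc, hσ, Matrix.mul_sub, Matrix.mul_one, Matrix.mul_vecMulVec,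
      ← Matrix.mulVec_mulVec, hA, Matrix.mulVec_smul, hπ]
    simp
  · rw [Matrix.mul_assoc, hσ, Matrix.mul_sub, Matrix.mul_one, Matrix.mul_vecMulVec, hC]
    simp

/-- A minimal realization is controllable: no left eigenvector is in the left kernel of `B`. -/
theorem IsMinimalRealization.eq_zero_of_left_eigenvector {T : RatMatrix a b} {A : Matrix n n ℂ}
    {B : Matrix n b ℂ} {C : Matrix a n ℂ} {D : Matrix a b ℂ} (h : IsMinimalRealization T A B C D)
    {u : n → ℂ} {μ : ℂ} (hA : u ᵥ* A = μ • u) (hB : u ᵥ* B = 0) : u = 0 :=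
  h.transpose.eq_zero_of_eigenvector (μ := μ) (by rwa [Matrix.mulVec_transpose])
    (by rwa [Matrix.mulVec_transpose])

end

/-! ### The Stein equation -/

section

variable {n m : Type} [Fintype n] [DecidableEq n]

theorem isUnit_smul_one_sub {A : Matrix n n ℂ} {c : ℂ} (hc : c ∉ spectrum ℂ A) :
    IsUnit (c • (1 : Matrix n n ℂ) - A) := by
  rw [spectrum.notMem_iff, Algebra.algebraMap_eq_smul_one] at hc
  exact hc

theorem mem_spectrum_conjTranspose {A : Matrix n n ℂ} {c : ℂ} (hc : c ∈ spectrum ℂ Aᴴ) :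
    star c ∈ spectrum ℂ A := by
  rw [← Matrix.star_eq_conjTranspose, spectrum.map_star] at hc
  exact hc

theorem isUnit_of_antistable {A : Matrix n n ℂ}
    (hA : ∀ μ ∈ spectrum ℂ A, 1 < ‖μ‖) : IsUnit A :=
  spectrum.isUnit_of_zero_notMem ℂ fun h => by
    have := hA 0 h
    norm_num at this

theorem isUnit_one_sub_of_antistable {A : Matrix n n ℂ}
    (hA : ∀ μ ∈ spectrum ℂ A, 1 < ‖μ‖) : IsUnit (1 - A) := by
  have := isUnit_smul_one_sub (A := A) (c := 1) fun h => by
    have := hA 1 h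
    norm_num at this
  rwa [one_smul] at this

theorem isUnit_sub_conjTranspose_of_antistable {A : Matrix n n ℂ}
    (hA : ∀ μ ∈ spectrum ℂ A, 1 < ‖μ‖) {c : ℂ} (hc : ‖c‖ ≤ 1) :
    IsUnit (c • (1 : Matrix n n ℂ) - Aᴴ) :=
  isUnit_smul_one_sub fun h => by
    have := hA _ (mem_spectrum_conjTranspose h)
    rw [norm_star] at this
    exact absurd hc (not_le.mpr this)

theorem norm_lt_one_of_mem_spectrum_inv {A : Matrix n n ℂ}
    (hA : ∀ μ ∈ spectrum ℂ A, 1 < ‖μ‖) {μ : ℂ} (h : μ ∈ spectrum ℂ A⁻¹) : ‖μ‖ < 1 := by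
  obtain ⟨u, hu⟩ := isUnit_of_antistable hA
  have h' : μ ∈ spectrum ℂ ((u⁻¹ : (Matrix n n ℂ)ˣ) : Matrix n n ℂ) := by
    rw [Matrix.coe_units_inv, hu]
    exact h
  rw [← spectrum.inv₀_mem_iff, hu] at h'
  have h1 := hA _ h'
  rw [norm_inv] at h1
  exact (one_lt_inv_iff₀.mp h1).2

/-- The equation reads `Aᴴ Y = Y A⁻¹`, an intertwining of matrices with disjoint spectra. The
characteristic polynomial of `Aᴴ` kills the left side, while its value at `A⁻¹` is invertible. -/
theorem eq_zero_of_eq_conjTranspose_mul_mul {A : Matrix n n ℂ}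
    (hA : ∀ μ ∈ spectrum ℂ A, 1 < ‖μ‖) {Y : Matrix n n ℂ} (hY : Y = Aᴴ * Y * A) : Y = 0 := by
  have hu := (Matrix.isUnit_iff_isUnit_det _).mp (isUnit_of_antistable hA)
  have h1 : Aᴴ * Y = Y * A⁻¹ := by
    nth_rw 2 [hY]
    rw [Matrix.mul_nonsing_inv_cancel_right _ _ hu]
  have h2 (p : Polynomial ℂ) : Polynomial.aeval Aᴴ p * Y = Y * Polynomial.aeval A⁻¹ p := by
    induction p using Polynomial.induction_on' with
    | add p q hp hq => rw [map_add, map_add, add_mul, mul_add, hp, hq]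
    | monomial k c =>
      have hk : (Aᴴ) ^ k * Y = Y * A⁻¹ ^ k := by
        induction k with
        | zero => simp
        | succ k ih => rw [pow_succ, pow_succ', Matrix.mul_assoc, h1, ← Matrix.mul_assoc, ih,
            Matrix.mul_assoc, ← pow_succ, ← pow_succ']
      simp only [Polynomial.aeval_monomial, Algebra.algebraMap_eq_smul_one, smul_mul_assoc, one_mul,
        mul_smul_comm, hk]
  have h3 := h2 (Aᴴ).charpoly
  rw [Matrix.aeval_self_charpoly, zero_mul] at h3
  cases isEmpty_or_nonempty n
  · exact Subsingleton.elim _ _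
  have h4 : IsUnit (Polynomial.aeval A⁻¹ (Aᴴ).charpoly) := by
    refine spectrum.isUnit_of_zero_notMem ℂ fun h0 => ?_
    rw [spectrum.map_polynomial_aeval_of_nonempty _ _
      (spectrum.nonempty_of_isAlgClosed_of_finiteDimensional ℂ _)] at h0
    obtain ⟨μ, hμ, hμ0⟩ := h0
    have h5 : μ ∈ spectrum ℂ Aᴴ := Matrix.mem_spectrum_of_isRoot_charpoly hμ0
    have h6 := hA _ (mem_spectrum_conjTranspose h5)
    rw [norm_star] at h6
    exact absurd (norm_lt_one_of_mem_spectrum_inv hA hμ) (not_lt.mpr h6.le)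
  exact (h4.mul_left_eq_zero).mp h3.symm

theorem existsUnique_stein {A : Matrix n n ℂ}
    (hA : ∀ μ ∈ spectrum ℂ A, 1 < ‖μ‖) (K : Matrix n n ℂ) :
    ∃! X : Matrix n n ℂ, X - Aᴴ * X * A - K = 0 := by
  let f : Matrix n n ℂ →ₗ[ℂ] Matrix n n ℂ :=
    LinearMap.id - (LinearMap.mulRight ℂ A).comp (LinearMap.mulLeft ℂ Aᴴ)
  have hf (Y : Matrix n n ℂ) : f Y = Y - Aᴴ * Y * A := rfl
  have hinj : Function.Injective f := by
    rw [← LinearMap.ker_eq_bot, LinearMap.ker_eq_bot']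
    intro Y hY
    rw [hf, sub_eq_zero] at hY
    exact eq_zero_of_eq_conjTranspose_mul_mul hA hY
  obtain ⟨X, hX⟩ := (LinearMap.injective_iff_surjective.mp hinj) K
  refine ⟨X, sub_eq_zero.mpr hX, fun Y hY => hinj ?_⟩
  rw [hX, ← sub_eq_zero]
  exact hY

open Filter Topology in
theorem tendsto_pow_zero_of_spectrum {B : Matrix n n ℂ} (hB : ∀ μ ∈ spectrum ℂ B, ‖μ‖ < 1) :
    Tendsto (fun k : ℕ => B ^ k) atTop (𝓝 0) := by
  cases isEmpty_or_nonempty n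
  · exact tendsto_const_nhds.congr fun k => Subsingleton.elim _ _
  let _ := Matrix.linftyOpNormedRing (n := n) (α := ℂ)
  let _ := Matrix.linftyOpNormedAlgebra (n := n) (R := ℂ) (α := ℂ)
  -- Gelfand's formula turns a spectral radius below `1` into geometric decay of the powers.
  have h1 : spectralRadius ℂ B < ((1 : NNReal) : ENNReal) :=
    spectrum.spectralRadius_lt_of_forall_lt_of_nonempty
      (spectrum.nonempty_of_isAlgClosed_of_finiteDimensional ℂ B) hB
  obtain ⟨r, hr1, hr2⟩ := ENNReal.lt_iff_exists_nnreal_btwn.mp h1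
  have h2 := (spectrum.pow_nnnorm_pow_one_div_tendsto_nhds_spectralRadius B).eventually_lt_const hr1
  have h3 : ∀ᶠ k : ℕ in atTop, ‖B ^ k‖ ≤ (r : ℝ) ^ k := by
    filter_upwards [h2, eventually_ge_atTop 1] with k hk hk1
    have hk0 : (k : ℝ) ≠ 0 := by positivity
    have h4 := ENNReal.rpow_le_rpow hk.le (Nat.cast_nonneg (α := ℝ) k)
    rw [← ENNReal.rpow_mul, one_div_mul_cancel hk0, ENNReal.rpow_one, ENNReal.rpow_natCast,
      ← ENNReal.coe_pow, ENNReal.coe_le_coe] at h4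
    exact_mod_cast h4
  refine squeeze_zero_norm' h3 (tendsto_pow_atTop_nhds_zero_of_lt_one r.2 ?_)
  exact_mod_cast hr2

open Filter Topology in
/-- For an observable pair `(C, A)` with `A` antistable, the Stein solution is invertible. -/
theorem isUnit_of_stein [Fintype m] {A X : Matrix n n ℂ} {C : Matrix m n ℂ}
    (hA : ∀ μ ∈ spectrum ℂ A, 1 < ‖μ‖)
    (hC : ∀ (x : n → ℂ) (μ : ℂ), A *ᵥ x = μ • x → C *ᵥ x = 0 → x = 0)
    (hX : X - Aᴴ * X * A - Cᴴ * C = 0) : IsUnit X := by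
  have hAu := (Matrix.isUnit_iff_isUnit_det _).mp (isUnit_of_antistable hA)
  by_contra hXu
  have hdet : X.det = 0 := by
    rw [Matrix.isUnit_iff_isUnit_det] at hXu
    simpa using hXu
  obtain ⟨x, hx0, hx⟩ := Matrix.exists_mulVec_eq_zero_iff.mpr hdet
  -- Along the backward orbit of a kernel vector of `X`, the form `y^* X y` grows by `‖C y‖²` at
  -- each step. It starts at `0` and tends to `0`, so every increment vanishes.
  set y : ℕ → n → ℂ := fun k => A⁻¹ ^ k *ᵥ x with hy
  have hAy (k : ℕ) : A *ᵥ y (k + 1) = y k := by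
    rw [hy]
    simp only [pow_succ', Matrix.mulVec_mulVec]
    rw [← Matrix.mul_assoc, Matrix.mul_nonsing_inv _ hAu, Matrix.one_mul]
  set g : ℕ → ℝ := fun k => (star (y k) ⬝ᵥ X *ᵥ y k).re with hg
  have hstep (k : ℕ) : g (k + 1) = g k + (star (C *ᵥ y (k + 1)) ⬝ᵥ C *ᵥ y (k + 1)).re := by
    have hX' : X = Aᴴ * X * A + Cᴴ * C := by
      rw [sub_sub, sub_eq_zero] at hX
      exact hX
    have e : star (y (k + 1)) ⬝ᵥ X *ᵥ y (k + 1) = star (y k) ⬝ᵥ X *ᵥ y k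
        + star (C *ᵥ y (k + 1)) ⬝ᵥ C *ᵥ y (k + 1) := by
      rw [← hAy k]
      generalize y (k + 1) = v
      nth_rw 1 [hX']
      rw [Matrix.add_mulVec, dotProduct_add, Matrix.star_mulVec, Matrix.star_mulVec,
        ← Matrix.dotProduct_mulVec, ← Matrix.dotProduct_mulVec]
      simp only [Matrix.mulVec_mulVec, Matrix.mul_assoc]
    rw [hg]
    simp only [e, Complex.add_re]
  have hpos (v : m → ℂ) : 0 ≤ (star v ⬝ᵥ v).re :=
    (Complex.le_def.mp (dotProduct_star_self_nonneg v)).1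
  have hmono : Monotone g := monotone_nat_of_le_succ fun k => by
    rw [hstep]
    exact le_add_of_nonneg_right (hpos _)
  have hlim : Tendsto g atTop (𝓝 0) := by
    have h1 := tendsto_pow_zero_of_spectrum fun μ hμ => norm_lt_one_of_mem_spectrum_inv hA hμ
    have hcont : Continuous fun M : Matrix n n ℂ => (star (M *ᵥ x) ⬝ᵥ X *ᵥ (M *ᵥ x)).re := by
      refine Complex.continuous_re.comp ?_
      have : Continuous fun M : Matrix n n ℂ => M *ᵥ x := by fun_prop
      exact Continuous.dotProduct this.star (by fun_prop)
    exact (hcont.tendsto' 0 0 (by simp)).comp h1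
  have hg0 (k : ℕ) : g k = 0 := by
    refine le_antisymm (hmono.ge_of_tendsto hlim k) ?_
    have : g 0 = 0 := by simp [hg, hy, hx]
    rw [← this]
    exact hmono (Nat.zero_le k)
  have hCy (k : ℕ) : C *ᵥ y (k + 1) = 0 := by
    have h1 := hstep k
    rw [hg0, hg0, zero_add] at h1
    have h2 : star (C *ᵥ y (k + 1)) ⬝ᵥ C *ᵥ y (k + 1) = 0 :=
      Complex.ext h1.symm (Complex.le_def.mp (dotProduct_star_self_nonneg _)).2.symm
    exact dotProduct_star_self_eq_zero.mp h2
  -- This unobservable subspace is invariant under `A⁻¹` and contains `y 1 ≠ 0`. It therefore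
  -- contains an eigenvector of `A⁻¹`, hence one of `A` in the kernel of `C`.
  let K : Submodule ℂ (n → ℂ) := ⨅ k : ℕ, LinearMap.ker (C * A⁻¹ ^ k).mulVecLin
  have hK (v : n → ℂ) : v ∈ K ↔ ∀ k : ℕ, (C * A⁻¹ ^ k) *ᵥ v = 0 := by
    simp [K, Submodule.mem_iInf]
  have hKinv : ∀ v ∈ K, A⁻¹.mulVecLin v ∈ K := fun v hv => (hK _).mpr fun k => by
    rw [Matrix.mulVecLin_apply, Matrix.mulVec_mulVec, Matrix.mul_assoc, ← pow_succ]
    exact (hK v).mp hv (k + 1)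
  have hy1 : y 1 ∈ K := (hK _).mpr fun k => by
    rw [hy]
    simp only
    rw [Matrix.mulVec_mulVec, Matrix.mul_assoc, ← pow_add, ← Matrix.mulVec_mulVec]
    exact hCy k
  have hy1' : y 1 ≠ 0 := fun h0 => hx0 <| by
    have := hAy 0
    rw [zero_add, h0, Matrix.mulVec_zero] at this
    simpa [hy] using this.symm
  have : Nontrivial K := ⟨⟨⟨y 1, hy1⟩, 0, fun h => hy1' (congrArg Subtype.val h)⟩⟩
  obtain ⟨μ, hμ⟩ := Module.End.exists_eigenvalue (A⁻¹.mulVecLin.restrict hKinv)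
  obtain ⟨v, hv⟩ := hμ.exists_hasEigenvector
  have hv1 : A⁻¹ *ᵥ (v : n → ℂ) = μ • (v : n → ℂ) := congrArg Subtype.val hv.apply_eq_smul
  have hv0 : (v : n → ℂ) ≠ 0 := fun h => hv.2 (Subtype.ext h)
  have hv2 : (v : n → ℂ) = μ • A *ᵥ (v : n → ℂ) := by
    rw [← Matrix.mulVec_smul, ← hv1, Matrix.mulVec_mulVec, Matrix.mul_nonsing_inv _ hAu,
      Matrix.one_mulVec]
  have hμ0 : μ ≠ 0 := fun h => hv0 (by rw [hv2, h, zero_smul])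
  refine hv0 (hC v μ⁻¹ ?_ ?_)
  · nth_rw 2 [hv2]
    rw [smul_smul, inv_mul_cancel₀ hμ0, one_smul]
  · simpa using (hK _).mp v.2 0

end

/-! ### The feedback pencil -/

section

variable {n m : Type} [Fintype n] [DecidableEq n] [Fintype m]

/-- With `M = -X⁻¹ (1 - A)⁻* C*`, the Stein equation diagonalizes the pencil `A + (1 - z) M C`. -/
theorem stein_pencil {A X : Matrix n n ℂ} {C : Matrix m n ℂ} (hX : X - Aᴴ * X * A - Cᴴ * C = 0)
    (hXu : IsUnit X) (hA : IsUnit (1 - A)) {M : Matrix n m ℂ}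
    (hM : M = -(X⁻¹ * ((1 - A)⁻¹)ᴴ * Cᴴ)) :
    1 + M * C = -(X⁻¹ * Aᴴ * (((1 - A)⁻¹)ᴴ * X * (1 - A))) ∧
      A + M * C = -(X⁻¹ * (((1 - A)⁻¹)ᴴ * X * (1 - A))) := by
  rw [Matrix.isUnit_iff_isUnit_det] at hXu hA
  set E := ((1 - A)⁻¹)ᴴ with hE
  have hE1 : E * (1 - Aᴴ) = 1 := by
    have := congrArg Matrix.conjTranspose (Matrix.mul_nonsing_inv _ hA)
    simpa [hE] using this
  have hE2 : (1 - Aᴴ) * E = 1 := mul_eq_one_comm.mp hE1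
  have hK : Cᴴ * C = X - Aᴴ * X * A := (sub_eq_zero.mp hX).symm
  -- Splitting `C^* C` as `(1 - A^*) X A + X (1 - A)` lets `E = (1 - A)⁻*` cancel in the first term.
  have hEK : E * (Cᴴ * C) = X * A + E * X * (1 - A) := by
    have : Cᴴ * C = (1 - Aᴴ) * (X * A) + X * (1 - A) := by rw [hK]; noncomm_ring
    rw [this, Matrix.mul_add, ← Matrix.mul_assoc, hE1, Matrix.one_mul, Matrix.mul_assoc]
  have hMC : M * C = -(A + X⁻¹ * (E * X * (1 - A))) := by
    rw [hM, Matrix.neg_mul, Matrix.mul_assoc, Matrix.mul_assoc, hEK, Matrix.mul_add,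
      Matrix.nonsing_inv_mul_cancel_left _ _ hXu]
  have hAE : Aᴴ * E = E - 1 := by
    rw [← hE2]; noncomm_ring
  constructor
  · have h1 : X⁻¹ * Aᴴ * (E * X * (1 - A)) = X⁻¹ * (E * X * (1 - A)) - (1 - A) := by
      rw [← Matrix.mul_assoc, ← Matrix.mul_assoc, Matrix.mul_assoc X⁻¹, hAE]
      have : X⁻¹ * X * (1 - A) = 1 - A := by rw [Matrix.nonsing_inv_mul _ hXu, Matrix.one_mul]
      nth_rw 3 [← this]
      noncomm_ring
    rw [hMC, h1]
    abel
  · rw [hMC]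
    abel

/-- The pencil is `(1 + K) - w (A + K)`, and both coefficients share the outer factors `F` and `H`.
-/
theorem feedback_pencil_eq {R : Type} [CommRing R] {A K F G H : Matrix n n R}
    (h1 : 1 + K = -(F * G * H)) (h2 : A + K = -(F * H)) (w : R) :
    1 - w • A - (w - 1) • K = F * (w • 1 - G) * H := by
  have h3 : 1 - w • A - (w - 1) • K = (1 + K) - w • (A + K) := by
    simp only [sub_smul, smul_add, one_smul]; abel
  rw [h3, h1, h2]
  simp only [Matrix.mul_sub, Matrix.sub_mul, Matrix.mul_smul, Matrix.smul_mul, Matrix.mul_one,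
    smul_neg]
  abel

/-- Passing from `z` to `w = 1 / z` in a transfer matrix. -/
theorem transfer_eq_inv_X {a b : Type} {A N : RatMatrix n n} {B : RatMatrix n b}
    {B' : RatMatrix n b} (C : RatMatrix a n) (D : RatMatrix a b)
    (hN : N = 1 - (RatFunc.X : RatFunc ℂ)⁻¹ • A) (hB : B' = (RatFunc.X : RatFunc ℂ)⁻¹ • B)
    (hu : IsUnit N) : transfer A B C D = C * N⁻¹ * B' + D := by
  rw [Matrix.isUnit_iff_isUnit_det] at hu
  have hX : (RatFunc.X : RatFunc ℂ) ≠ 0 := RatFunc.X_ne_zero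
  have h1 : (RatFunc.X : RatFunc ℂ) • (1 : RatMatrix n n) - A = (RatFunc.X : RatFunc ℂ) • N := by
    rw [hN, smul_sub, smul_smul, mul_inv_cancel₀ hX, one_smul]
  have h2 : ((RatFunc.X : RatFunc ℂ) • N)⁻¹ = (RatFunc.X : RatFunc ℂ)⁻¹ • N⁻¹ :=
    Matrix.inv_smul' N (Units.mk0 (RatFunc.X : RatFunc ℂ) hX) hu
  rw [transfer, h1, h2, hB]
  simp

end

/-! ### Matrix identities: block pencils, output injection, para-unitarity -/

section

variable {R : Type} [CommRing R] {k m p : Type} [Fintype k] [DecidableEq k] [Fintype m] [DecidableEq m]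

theorem fromBlocks_pencil {R : Type} [CommRing R] {k l m : Type} [DecidableEq k] [DecidableEq l]
    [Fintype m] (Au : Matrix k k R) (Aus : Matrix k l R) (As : Matrix l l R)
    (M : Matrix k m R) (Cu : Matrix m k R) (Cs : Matrix m l R) (w : R) :
    1 - w • Matrix.fromBlocks Au Aus 0 As
        - (w - 1) • (Matrix.fromRows M 0 * Matrix.fromCols Cu Cs)
      = Matrix.fromBlocks (1 - w • Au - (w - 1) • (M * Cu)) (-(w • Aus) - (w - 1) • (M * Cs)) 0
          (1 - w • As) := by
  rw [Matrix.fromRows_mul_fromCols, ← Matrix.fromBlocks_one]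
  simp only [Matrix.fromBlocks_smul, sub_eq_add_neg, Matrix.fromBlocks_neg, Matrix.fromBlocks_add,
    Matrix.zero_mul, smul_zero, neg_zero, add_zero, zero_add]

/-- Output injection multiplies the transfer matrix from the left. -/
theorem output_injection {N₀ N : Matrix k k R} {B : Matrix k p R} {C : Matrix m k R}
    {D : Matrix m p R} {L : Matrix k m R} (hN : N = N₀ - L * C) (h₀ : IsUnit N₀) (h : IsUnit N) :
    C * N⁻¹ * (B + L * D) + D = (C * N⁻¹ * L + 1) * (C * N₀⁻¹ * B + D) := by
  rw [Matrix.isUnit_iff_isUnit_det] at h₀ h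
  have h1 : C * N⁻¹ * L * (C * N₀⁻¹ * B) = C * N⁻¹ * B - C * N₀⁻¹ * B := by
    -- The resolvent identity: `N⁻¹ (N₀ - N) N₀⁻¹ = N⁻¹ - N₀⁻¹`.
    have h2 : L * C = N₀ - N := by rw [hN]; abel
    calc _ = C * (N⁻¹ * ((L * C) * (N₀⁻¹ * B))) := by simp only [Matrix.mul_assoc]
      _ = C * (N⁻¹ * (N₀ * (N₀⁻¹ * B)) - N⁻¹ * (N * (N₀⁻¹ * B))) := by
        rw [h2, Matrix.sub_mul, Matrix.mul_sub]
      _ = _ := by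
        rw [Matrix.mul_nonsing_inv_cancel_left _ _ h₀, Matrix.nonsing_inv_mul_cancel_left _ _ h,
          Matrix.mul_sub]
        simp only [Matrix.mul_assoc]
  rw [Matrix.add_mul, Matrix.mul_add, Matrix.mul_add _ _ D, h1, Matrix.one_mul]
  simp only [Matrix.mul_assoc]
  abel

/-- Meant for `q = 1 - α C a C^*` and `q^* = 1 - β C b C^*` with `K = C^* C`: the conclusion says
that the linear terms of `q q^*` cancel the quadratic one. -/
theorem paraUnitary_identity {P₁ P₂ a b K : Matrix k k R} {α β : R} (ha : a * P₁ = 1)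
    (hb : P₂ * b = 1) (h : α • P₂ + β • P₁ = (α * β) • K) :
    α • a + β • b = (α * β) • (a * K * b) := by
  have h1 : a * (α • P₂ + β • P₁) * b = α • a + β • b := by
    rw [Matrix.mul_add, Matrix.add_mul, Matrix.mul_smul, Matrix.mul_smul, ha, Matrix.smul_mul,
      Matrix.smul_mul, Matrix.one_mul, Matrix.mul_assoc, hb, Matrix.mul_one]
  rw [← h1, h]
  simp only [Matrix.mul_smul, Matrix.smul_mul]

end

/-! ### The factor `q`: formulas, para-unitarity, coprimeness -/

namespace BlockSystem

variable {m p nu ns : ℕ} (S : BlockSystem m p nu ns)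

/-- The state matrix. -/
def A : Matrix (Fin nu ⊕ Fin ns) (Fin nu ⊕ Fin ns) ℂ := Matrix.fromBlocks S.Au S.Aus 0 S.As

/-- The input matrix. -/
def B : Matrix (Fin nu ⊕ Fin ns) (Fin p) ℂ := Matrix.fromRows S.Bu S.Bs

/-- The output matrix. -/
def C : Matrix (Fin m) (Fin nu ⊕ Fin ns) ℂ := Matrix.fromCols S.Cu S.Cs

/-- The injection matrix, extended by zero to the stable states. -/
def L (X : Matrix (Fin nu) (Fin nu) ℂ) : Matrix (Fin nu ⊕ Fin ns) (Fin m) ℂ :=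
  Matrix.fromRows (S.M X) 0

/-- The common factor `[A_u + R_u | (1 - z) M; C_u | I]` of `Q₁ᵀ` and `W₂ᵀ`. -/
def q (X : Matrix (Fin nu) (Fin nu) ℂ) : RatMatrix (Fin m) (Fin m) :=
  transfer (const S.Au + S.Ru X) (S.zM X) (const S.Cu) 1

/-- The feedback pencil on the unstable states, in the variable `1 / z`. -/
def pencilU (X : Matrix (Fin nu) (Fin nu) ℂ) : RatMatrix (Fin nu) (Fin nu) :=
  1 - (RatFunc.X : RatFunc ℂ)⁻¹ • const S.Au
    - ((RatFunc.X : RatFunc ℂ)⁻¹ - 1) • (const (S.M X) * const S.Cu)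

/-- The feedback pencil on all states, in the variable `1 / z`. -/
def pencil (X : Matrix (Fin nu) (Fin nu) ℂ) : RatMatrix (Fin nu ⊕ Fin ns) (Fin nu ⊕ Fin ns) :=
  1 - (RatFunc.X : RatFunc ℂ)⁻¹ • const S.A
    - ((RatFunc.X : RatFunc ℂ)⁻¹ - 1) • (const (S.L X) * const S.C)

theorem Q₁_eq (X : Matrix (Fin nu) (Fin nu) ℂ) (P : Matrix (Fin m) (Fin m) ℂ) :
    S.Q₁ X P = (const P * S.q X)ᵀ := by
  rw [Q₁, q, transfer, transfer, const_mul, Matrix.mul_add, Matrix.mul_one]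
  simp only [Matrix.mul_assoc]

theorem inv_X_mul_one_sub_X :
    (RatFunc.X : RatFunc ℂ)⁻¹ * (1 - RatFunc.X) = (RatFunc.X : RatFunc ℂ)⁻¹ - 1 := by
  rw [mul_sub, inv_mul_cancel₀ RatFunc.X_ne_zero, mul_one]

theorem const_A : const S.A = Matrix.fromBlocks (const S.Au) (const S.Aus) 0 (const S.As) := by
  rw [A, const, Matrix.fromBlocks_map]
  congr 1
  simp

theorem const_B : const S.B = Matrix.fromRows (const S.Bu) (const S.Bs) := by
  ext (i | i) j <;> rfl

theorem const_C : const S.C = Matrix.fromCols (const S.Cu) (const S.Cs) := by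
  ext i (j | j) <;> rfl

theorem const_L (X : Matrix (Fin nu) (Fin nu) ℂ) :
    const (S.L X) = Matrix.fromRows (const (S.M X)) 0 := by
  ext (i | i) j
  · rfl
  · exact map_zero RatFunc.C

theorem pencil_eq (X : Matrix (Fin nu) (Fin nu) ℂ) :
    S.pencil X = Matrix.fromBlocks (S.pencilU X)
      (-((RatFunc.X : RatFunc ℂ)⁻¹ • const S.Aus)
        - ((RatFunc.X : RatFunc ℂ)⁻¹ - 1) • (const (S.M X) * const S.Cs)) 0
      (1 - (RatFunc.X : RatFunc ℂ)⁻¹ • const S.As) := by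
  rw [pencil, const_A, const_L, const_C, fromBlocks_pencil]
  rfl

/-- What the argument uses of the system and of the Stein solution `X`. -/
structure IsAdmissible (X : Matrix (Fin nu) (Fin nu) ℂ) : Prop where
  antistable : ∀ μ ∈ spectrum ℂ S.Au, 1 < ‖μ‖
  stable : ∀ μ ∈ spectrum ℂ S.As, ‖μ‖ ≤ 1
  stein : S.Stein X
  hermitian : X.IsHermitian
  isUnit : IsUnit X
  controllable : ∀ (u : Fin nu ⊕ Fin ns → ℂ) (μ : ℂ), u ᵥ* S.A = μ • u → u ᵥ* S.B = 0 → u = 0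

theorem existsUnique_stein_of_minimal {T : RatMatrix (Fin m) (Fin p)}
    (h : S.IsSplitMinimalRealization T) : ∃ X, S.IsAdmissible X ∧ ∀ Y, S.Stein Y → Y = X := by
  obtain ⟨X, hX, huniq⟩ := existsUnique_stein h.2.1 (S.Cuᴴ * S.Cu)
  refine ⟨X, ⟨h.2.1, h.2.2, hX, huniq _ ?_, isUnit_of_stein h.2.1 (fun x μ hA hC => ?_) hX,
    fun u μ hA hB => h.1.eq_zero_of_left_eigenvector hA hB⟩, huniq⟩
  -- The conjugate transpose of a solution is again a solution, so uniqueness makes `X` Hermitian.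
  · have := congrArg Matrix.conjTranspose hX
    simpa [Matrix.mul_assoc] using this
  · have h0 : Sum.elim x (0 : Fin ns → ℂ) = 0 := by
      refine h.1.eq_zero_of_eigenvector (μ := μ) ?_ ?_
      · rw [Matrix.fromBlocks_mulVec]
        ext (i | i) <;> simp [hA]
      · rw [Matrix.fromCols_mulVec]
        simp [hC]
    ext i
    exact congrFun h0 (Sum.inl i)

section

variable {S} {X : Matrix (Fin nu) (Fin nu) ℂ}

theorem IsAdmissible.isUnit_one_sub (h : S.IsAdmissible X) : IsUnit (1 - S.Au) :=
  isUnit_one_sub_of_antistable h.antistable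

theorem IsAdmissible.pencil_value (h : S.IsAdmissible X) (w : ℂ) :
    1 - w • S.Au - (w - 1) • (S.M X * S.Cu)
      = X⁻¹ * (w • 1 - S.Auᴴ) * (((1 - S.Au)⁻¹)ᴴ * X * (1 - S.Au)) :=
  feedback_pencil_eq (stein_pencil h.stein h.isUnit h.isUnit_one_sub rfl).1
    (stein_pencil h.stein h.isUnit h.isUnit_one_sub rfl).2 w

theorem IsAdmissible.pencilU_eq (h : S.IsAdmissible X) :
    S.pencilU X = const X⁻¹ * ((RatFunc.X : RatFunc ℂ)⁻¹ • 1 - const S.Auᴴ)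
      * const (((1 - S.Au)⁻¹)ᴴ * X * (1 - S.Au)) := by
  obtain ⟨h1, h2⟩ := stein_pencil h.stein h.isUnit h.isUnit_one_sub (M := S.M X) rfl
  refine feedback_pencil_eq ?_ ?_ _
  · rw [← const_one, ← const_mul, ← const_add, h1, const_neg, const_mul, const_mul]
  · rw [← const_mul, ← const_add, h2, const_neg, const_mul]

theorem IsAdmissible.isUnit_value (h : S.IsAdmissible X) {w : ℂ} (hw : ‖w‖ ≤ 1) :
    IsUnit (1 - w • S.Au - (w - 1) • (S.M X * S.Cu)) := by
  rw [h.pencil_value]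
  have h1 : IsUnit X⁻¹ := Matrix.isUnit_nonsing_inv_iff.mpr h.isUnit
  have h2 : IsUnit ((1 - S.Au)⁻¹)ᴴ :=
    (Matrix.isUnit_nonsing_inv_iff.mpr h.isUnit_one_sub).star
  exact (h1.mul (isUnit_sub_conjTranspose_of_antistable h.antistable hw)).mul
    ((h2.mul h.isUnit).mul h.isUnit_one_sub)

/-- The strict bound on `w` is needed because `A_s` may have eigenvalues on the unit circle. -/
theorem IsAdmissible.isUnit_value_full (h : S.IsAdmissible X) {w : ℂ} (hw : ‖w‖ < 1) :
    IsUnit (1 - w • S.A - (w - 1) • (S.L X * S.C)) := by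
  rw [A, L, C, fromBlocks_pencil, Matrix.isUnit_fromBlocks_zero₂₁]
  refine ⟨h.isUnit_value hw.le, ?_⟩
  by_cases hw0 : w = 0
  · simp [hw0]
  · have h1 : IsUnit (w⁻¹ • (1 : Matrix (Fin ns) (Fin ns) ℂ) - S.As) :=
      isUnit_smul_one_sub fun hmem => by
        have := h.stable _ hmem
        rw [norm_inv] at this
        exact absurd this (not_le.mpr ((one_lt_inv₀ (norm_pos_iff.mpr hw0)).mpr hw))
    have h2 := h1.smul (Units.mk0 w hw0)
    rw [Units.smul_def, Units.val_mk0, smul_sub, smul_smul, mul_inv_cancel₀ hw0, one_smul] at h2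
    exact h2

theorem value_sub_one {α : OnePoint ℂ} {r : RatFunc ℂ} (hr : r ∈ regularAt α) :
    value (r - 1) α = value r α - 1 := by
  simpa [valueHom_apply, value_one] using (valueHom α).map_sub ⟨r, hr⟩ 1

theorem IsAdmissible.hasValue_pencil {α : OnePoint ℂ} (hα : (RatFunc.X)⁻¹ ∈ regularAt α) :
    HasValue (S.pencil X) α (1 - value (RatFunc.X)⁻¹ α • S.A
      - (value (RatFunc.X)⁻¹ α - 1) • (S.L X * S.C)) := by
  rw [← value_sub_one hα]
  exact (hasValue_one.sub ((hasValue_const _).smul hα)).sub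
    (((hasValue_const _).mul (hasValue_const _)).smul (sub_mem hα (one_mem _)))

theorem IsAdmissible.hasValue_pencil_inv (h : S.IsAdmissible X) {α : OnePoint ℂ}
    (hα : α ∉ closedDisc) : IsUnit (S.pencil X) ∧ HasValue (S.pencil X)⁻¹ α
      (1 - value (RatFunc.X)⁻¹ α • S.A - (value (RatFunc.X)⁻¹ α - 1) • (S.L X * S.C))⁻¹ := by
  obtain ⟨hw, hw1⟩ := inv_X_regular_of_notMem_closedDisc hα
  exact (hasValue_pencil hw).inv (h.isUnit_value_full hw1)

theorem infty_notMem_closedDisc : (∞ : OnePoint ℂ) ∉ closedDisc :=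
  fun ⟨z, _, hz⟩ => OnePoint.coe_ne_infty z hz

theorem IsAdmissible.isUnit_pencil (h : S.IsAdmissible X) : IsUnit (S.pencil X) :=
  (h.hasValue_pencil_inv infty_notMem_closedDisc).1

theorem IsAdmissible.isUnit_pencilU (h : S.IsAdmissible X) : IsUnit (S.pencilU X) := by
  have := h.isUnit_pencil
  rw [pencil_eq, Matrix.isUnit_fromBlocks_zero₂₁] at this
  exact this.1

theorem IsAdmissible.q_eq_pencilU (h : S.IsAdmissible X) :
    S.q X = const S.Cu * (S.pencilU X)⁻¹
      * (((RatFunc.X : RatFunc ℂ)⁻¹ - 1) • const (S.M X)) + 1 := by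
  refine transfer_eq_inv_X _ _ ?_ ?_ h.isUnit_pencilU
  · rw [pencilU, Ru, zM, smul_add, Matrix.smul_mul, smul_smul, inv_X_mul_one_sub_X, sub_sub]
  · rw [zM, smul_smul, inv_X_mul_one_sub_X]

/-- The injection does not act on the stable states, so enlarging the state space leaves `q`
unchanged. In this form `q` is the left factor produced by `output_injection`. -/
theorem IsAdmissible.q_eq_pencil (h : S.IsAdmissible X) :
    S.q X = const S.C * (S.pencil X)⁻¹
      * (((RatFunc.X : RatFunc ℂ)⁻¹ - 1) • const (S.L X)) + 1 := by
  have h1 := (Matrix.isUnit_iff_isUnit_det _).mp h.isUnit_pencil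
  have h2 := (Matrix.isUnit_iff_isUnit_det _).mp h.isUnit_pencilU
  let Y : RatMatrix (Fin nu ⊕ Fin ns) (Fin m) :=
    Matrix.fromRows ((S.pencilU X)⁻¹ * const (S.M X)) 0
  have h3 : S.pencil X * Y = const (S.L X) := by
    rw [pencil_eq, Matrix.fromBlocks_mul_fromRows, const_L,
      Matrix.mul_nonsing_inv_cancel_left _ _ h2]
    simp
  have h4 : (S.pencil X)⁻¹ * const (S.L X) = Y := by
    rw [← h3, Matrix.nonsing_inv_mul_cancel_left _ _ h1]
  rw [h.q_eq_pencilU, Matrix.mul_smul, Matrix.mul_smul, Matrix.mul_assoc, Matrix.mul_assoc, h4,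
    const_C, Matrix.fromCols_mul_fromRows, Matrix.mul_zero, add_zero]

theorem IsAdmissible.q_mul_eq (h : S.IsAdmissible X) {T : RatMatrix (Fin m) (Fin p)}
    (hT : IsRealization T S.A S.B S.C S.D) :
    S.q X * T = const S.C * (S.pencil X)⁻¹ * ((RatFunc.X : RatFunc ℂ)⁻¹ • const S.B
      + (((RatFunc.X : RatFunc ℂ)⁻¹ - 1) • const (S.L X)) * const S.D) + const S.D := by
  obtain ⟨hw, hw0⟩ := inv_X_mem_regularAt_infty
  have hN₀ : IsUnit ((1 : RatMatrix _ _) - (RatFunc.X : RatFunc ℂ)⁻¹ • const S.A) := by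
    refine (HasValue.inv (α := ∞) (V := 1) ?_ isUnit_one).1
    convert hasValue_one.sub (HasValue.smul hw (hasValue_const S.A)) using 1
    rw [hw0, zero_smul, sub_zero]
  have h1 := output_injection (N := S.pencil X) (B := (RatFunc.X : RatFunc ℂ)⁻¹ • const S.B)
    (C := const S.C) (D := const S.D) (L := ((RatFunc.X : RatFunc ℂ)⁻¹ - 1) • const (S.L X))
    (by rw [pencil, Matrix.smul_mul]) hN₀ h.isUnit_pencil
  rw [h1, ← h.q_eq_pencil, hT, transfer_eq_inv_X _ _ rfl rfl hN₀]

theorem IsAdmissible.W₂_eq (h : S.IsAdmissible X) {T : RatMatrix (Fin m) (Fin p)}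
    (hT : IsRealization T S.A S.B S.C S.D) (P : Matrix (Fin m) (Fin m) ℂ) :
    S.W₂ X P = (const P * (S.q X * T))ᵀ := by
  rw [h.q_mul_eq hT, W₂]
  congr 1
  have hC : Matrix.fromCols (const (P * S.Cu)) (const (P * S.Cs)) = const P * const S.C := by
    rw [const_C, Matrix.mul_fromCols, const_mul, const_mul]
  rw [transfer_eq_inv_X (N := S.pencil X)
    (B' := (RatFunc.X : RatFunc ℂ)⁻¹ • const S.B
      + (((RatFunc.X : RatFunc ℂ)⁻¹ - 1) • const (S.L X)) * const S.D) _ _ ?_ ?_ h.isUnit_pencil]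
  · rw [hC, const_mul]
    simp only [Matrix.mul_add, Matrix.mul_assoc]
  · have : Matrix.fromBlocks (const S.Au + S.Ru X) (const S.Aus + S.Rs X) 0 (const S.As)
        = const S.A + (1 - RatFunc.X : RatFunc ℂ) • (const (S.L X) * const S.C) := by
      rw [const_A, const_L, const_C, Matrix.fromRows_mul_fromCols, Matrix.fromBlocks_smul,
        Matrix.fromBlocks_add, Ru, Rs, zM]
      simp
    rw [this, pencil, smul_add, smul_smul, inv_X_mul_one_sub_X, sub_sub]
  · have : Matrix.fromRows (const S.Bu + S.RD X) (const S.Bs)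
        = const S.B + (1 - RatFunc.X : RatFunc ℂ) • (const (S.L X) * const S.D) := by
      rw [const_B, const_L, RD, zM]
      ext (i | i) j <;> simp [Matrix.fromRows_mul]
    rw [this, smul_add, smul_smul, inv_X_mul_one_sub_X, Matrix.smul_mul]

/-- `F = 1/z - A_u^*`, whose zeros are the poles of `q`. -/
theorem IsAdmissible.hasValue_inv_sub (h : S.IsAdmissible X) {α : OnePoint ℂ}
    (hα : α ∉ openDisc) :
    IsUnit ((RatFunc.X : RatFunc ℂ)⁻¹ • (1 : RatMatrix _ _) - const S.Auᴴ) ∧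
      HasValue ((RatFunc.X : RatFunc ℂ)⁻¹ • (1 : RatMatrix _ _) - const S.Auᴴ)⁻¹ α
        (value (RatFunc.X)⁻¹ α • (1 : Matrix _ _ ℂ) - S.Auᴴ)⁻¹ := by
  obtain ⟨hw, hw1⟩ := inv_X_regular_of_notMem_openDisc hα
  exact ((hasValue_one.smul hw).sub (hasValue_const _)).inv
    (isUnit_sub_conjTranspose_of_antistable h.antistable hw1)

theorem IsAdmissible.isUnit_inv_sub (h : S.IsAdmissible X) :
    IsUnit ((RatFunc.X : RatFunc ℂ)⁻¹ • (1 : RatMatrix _ _) - const S.Auᴴ) :=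
  (h.hasValue_inv_sub (notMem_openDisc_of_notMem_closedDisc infty_notMem_closedDisc)).1

/-- The factor `(1 - A_u)⁻*` in `M` commutes with `1/z - A_u^*` and cancels against the one in the
pencil. What remains shows the poles of `q` and is suited to computing `q q^*`. -/
theorem IsAdmissible.q_eq (h : S.IsAdmissible X) :
    S.q X = 1 - ((RatFunc.X : RatFunc ℂ)⁻¹ - 1) • (const S.Cu * (const ((1 - S.Au)⁻¹ * X⁻¹)
      * ((RatFunc.X : RatFunc ℂ)⁻¹ • (1 : RatMatrix _ _) - const S.Auᴴ)⁻¹) * const S.Cuᴴ) := by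
  set F := (RatFunc.X : RatFunc ℂ)⁻¹ • (1 : RatMatrix _ _) - const S.Auᴴ with hF
  have hFu := (Matrix.isUnit_iff_isUnit_det _).mp h.isUnit_inv_sub
  have hU := (Matrix.isUnit_iff_isUnit_det _).mp h.isUnit_pencilU
  have hXu := (Matrix.isUnit_iff_isUnit_det _).mp h.isUnit
  have hA := (Matrix.isUnit_iff_isUnit_det _).mp h.isUnit_one_sub
  have hcomm : F * const ((1 - S.Au)⁻¹)ᴴ = const ((1 - S.Au)⁻¹)ᴴ * F := by
    have h1 : S.Auᴴ * ((1 - S.Au)⁻¹)ᴴ = ((1 - S.Au)⁻¹)ᴴ * S.Auᴴ := by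
      have h2 : (1 - S.Au)⁻¹ * S.Au = S.Au * (1 - S.Au)⁻¹ := by
        have e1 : S.Au = 1 - (1 - S.Au) := by abel
        nth_rw 2 3 [e1]
        rw [Matrix.mul_sub, Matrix.sub_mul, Matrix.mul_nonsing_inv _ hA,
          Matrix.nonsing_inv_mul _ hA, Matrix.mul_one, Matrix.one_mul]
      rw [← Matrix.conjTranspose_mul, h2, Matrix.conjTranspose_mul]
    rw [hF, Matrix.sub_mul, Matrix.mul_sub, ← const_mul, ← const_mul, h1]
    simp
  have h1 : S.pencilU X * (const ((1 - S.Au)⁻¹ * X⁻¹) * F⁻¹)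
      = const (X⁻¹ * ((1 - S.Au)⁻¹)ᴴ) := by
    have e : ((1 - S.Au)⁻¹)ᴴ * X * (1 - S.Au) * ((1 - S.Au)⁻¹ * X⁻¹) = ((1 - S.Au)⁻¹)ᴴ := by
      rw [← Matrix.mul_assoc, Matrix.mul_nonsing_inv_cancel_right _ _ hA,
        Matrix.mul_nonsing_inv_cancel_right _ _ hXu]
    rw [h.pencilU_eq, ← hF, ← Matrix.mul_assoc, Matrix.mul_assoc _ (const _) (const _),
      ← const_mul, e, Matrix.mul_assoc (const X⁻¹), hcomm, ← Matrix.mul_assoc,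
      Matrix.mul_nonsing_inv_cancel_right _ _ hFu, const_mul]
  have h2 : (S.pencilU X)⁻¹ * const (S.M X)
      = -(const ((1 - S.Au)⁻¹ * X⁻¹) * F⁻¹ * const S.Cuᴴ) := by
    rw [M, const_neg, const_mul, ← h1, Matrix.mul_neg, Matrix.mul_assoc,
      Matrix.nonsing_inv_mul_cancel_left _ _ hU]
  rw [h.q_eq_pencilU, Matrix.mul_smul, Matrix.mul_assoc, h2, Matrix.mul_neg, smul_neg,
    Matrix.mul_assoc (const S.Cu)]
  abel

theorem IsAdmissible.q_regular (h : S.IsAdmissible X) {α : OnePoint ℂ} (hα : α ∉ openDisc)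
    (i j : Fin m) : S.q X i j ∈ regularAt α := by
  obtain ⟨hw, -⟩ := inv_X_regular_of_notMem_openDisc hα
  rw [h.q_eq]
  exact (hasValue_one.sub ((((hasValue_const _).mul ((hasValue_const _).mul
    (h.hasValue_inv_sub hα).2)).mul (hasValue_const _)).smul
      (sub_mem hw (one_mem _)))).1 i j

/-- The factor `1 - z` of the injection vanishes at `z = 1`. This normalization fixes the unitary
constant when realizations are compared. -/
theorem IsAdmissible.hasValue_q_one (h : S.IsAdmissible X) :
    HasValue (S.q X) ((1 : ℂ) : OnePoint ℂ) 1 := by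
  have hα : ((1 : ℂ) : OnePoint ℂ) ∉ openDisc := by
    rintro ⟨z, hz, e⟩
    rw [OnePoint.coe_eq_coe] at e
    simp [e] at hz
  obtain ⟨hw, hw1⟩ := inv_X_mem_regularAt (one_ne_zero (α := ℂ))
  have h1 := hasValue_one.sub ((((hasValue_const S.Cu).mul
    ((hasValue_const ((1 - S.Au)⁻¹ * X⁻¹)).mul (h.hasValue_inv_sub hα).2)).mul
      (hasValue_const S.Cuᴴ)).smul (sub_mem hw (one_mem _)))
  rw [value_sub_one hw, hw1, inv_one, sub_self, zero_smul, sub_zero] at h1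
  rw [h.q_eq]
  exact h1

theorem IsAdmissible.q_mul_paraStar (h : S.IsAdmissible X) : S.q X * paraStar (S.q X) = 1 := by
  have hFu := (Matrix.isUnit_iff_isUnit_det _).mp h.isUnit_inv_sub
  have hXu := (Matrix.isUnit_iff_isUnit_det _).mp h.isUnit
  have hA := (Matrix.isUnit_iff_isUnit_det _).mp h.isUnit_one_sub
  have hZ := (Matrix.isUnit_iff_isUnit_det _).mp (isUnit_X_sub_const S.Au)
  have hz : (RatFunc.X : RatFunc ℂ) ≠ 0 := RatFunc.X_ne_zero
  have hFs : paraStar ((RatFunc.X : RatFunc ℂ)⁻¹ • (1 : RatMatrix _ _) - const S.Auᴴ)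
      = (RatFunc.X : RatFunc ℂ) • 1 - const S.Au := by
    rw [paraStar_sub, paraStar_smul, paraStar_one, paraStar_const, Matrix.conjTranspose_conjTranspose,
      ← paraConj_X, paraConj_paraConj]
  have hws : paraConj ((RatFunc.X : RatFunc ℂ)⁻¹ - 1) = RatFunc.X - 1 := by
    rw [← paraConj_X, ← paraConjHom_apply, map_sub, map_one, paraConjHom_apply,
      paraConj_paraConj]
  set a := const ((1 - S.Au)⁻¹ * X⁻¹)
      * ((RatFunc.X : RatFunc ℂ)⁻¹ • (1 : RatMatrix _ _) - const S.Auᴴ)⁻¹ with ha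
  set b := ((RatFunc.X : RatFunc ℂ) • (1 : RatMatrix _ _) - const S.Au)⁻¹
      * const ((1 - S.Au)⁻¹ * X⁻¹)ᴴ with hb
  have hab : paraStar a = b := by
    rw [ha, paraStar_mul, paraStar_inv h.isUnit_inv_sub, hFs, paraStar_const]
  have hq : S.q X = 1 - ((RatFunc.X : RatFunc ℂ)⁻¹ - 1) • (const S.Cu * a * const S.Cuᴴ) := h.q_eq
  have hqs : paraStar (S.q X)
      = 1 - ((RatFunc.X : RatFunc ℂ) - 1) • (const S.Cu * b * const S.Cuᴴ) := by
    rw [hq, paraStar_sub, paraStar_one, paraStar_smul, hws, paraStar_mul, paraStar_mul, hab,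
      paraStar_const, paraStar_const, Matrix.conjTranspose_conjTranspose,
      Matrix.mul_assoc (const S.Cu) b]
  have ha1 : a * (((RatFunc.X : RatFunc ℂ)⁻¹ • (1 : RatMatrix _ _) - const S.Auᴴ)
      * const (X * (1 - S.Au))) = 1 := by
    rw [ha, Matrix.mul_assoc, Matrix.nonsing_inv_mul_cancel_left _ _ hFu, ← const_mul,
      Matrix.mul_assoc, Matrix.nonsing_inv_mul_cancel_left _ _ hXu, Matrix.nonsing_inv_mul _ hA,
      const_one]
  have hb1 : (const (X * (1 - S.Au))ᴴ * ((RatFunc.X : RatFunc ℂ) • 1 - const S.Au)) * b = 1 := by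
    rw [hb, Matrix.mul_assoc, Matrix.mul_nonsing_inv_cancel_left _ _ hZ, ← const_mul,
      ← Matrix.conjTranspose_mul, Matrix.mul_assoc, Matrix.nonsing_inv_mul_cancel_left _ _ hXu,
      Matrix.nonsing_inv_mul _ hA, Matrix.conjTranspose_one, const_one]
  have hK : const S.Cuᴴ * const S.Cu = const X - const S.Auᴴ * const X * const S.Au := by
    rw [← const_mul, ← const_mul, ← const_mul, ← const_sub]
    exact congrArg const (sub_eq_zero.mp h.stein).symm
  -- With `w z = 1` the hypothesis is `(w - 1)(1 - A^*) X (z - A) + (z - 1)(w - A^*) X (1 - A) = (w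
  -- - 1)(z - 1)(X - A^* X A)`: the terms in `X A` and `A^* X` cancel, and the Stein equation
  -- identifies the right side.
  have key := paraUnitary_identity (α := (RatFunc.X : RatFunc ℂ)⁻¹ - 1)
    (β := (RatFunc.X : RatFunc ℂ) - 1) (K := const S.Cuᴴ * const S.Cu) ha1 hb1 (by
      rw [Matrix.conjTranspose_mul, h.hermitian.eq, Matrix.conjTranspose_sub,
        Matrix.conjTranspose_one, const_mul, const_mul, const_sub, const_sub, const_one, hK]
      have e1 : ((RatFunc.X : RatFunc ℂ)⁻¹ - 1) * (RatFunc.X - 1)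
          = (1 - RatFunc.X) + (1 - RatFunc.X⁻¹) := by
        field_simp
        ring
      have e2 : ((RatFunc.X : RatFunc ℂ)⁻¹ - 1) * RatFunc.X = 1 - RatFunc.X := by
        field_simp
      have e3 : ((RatFunc.X : RatFunc ℂ) - 1) * RatFunc.X⁻¹ = 1 - RatFunc.X⁻¹ := by
        field_simp
      rw [e1]
      simp only [Matrix.mul_sub, Matrix.sub_mul, Matrix.mul_smul, Matrix.smul_mul, Matrix.mul_one,
        Matrix.one_mul, smul_sub, smul_smul, e2, e3, Matrix.mul_assoc, sub_smul, add_smul,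
        one_smul]
      abel)
  rw [hqs, hq]
  have e : const S.Cu * a * const S.Cuᴴ * (const S.Cu * b * const S.Cuᴴ)
      = const S.Cu * (a * (const S.Cuᴴ * const S.Cu) * b) * const S.Cuᴴ := by
    simp only [Matrix.mul_assoc]
  have key' := congrArg (fun Y => const S.Cu * Y * const S.Cuᴴ) key
  simp only [Matrix.mul_add, Matrix.add_mul, Matrix.mul_smul, Matrix.smul_mul] at key'
  rw [Matrix.sub_mul, Matrix.mul_sub, Matrix.mul_sub, Matrix.one_mul, Matrix.mul_one,
    Matrix.one_mul, Matrix.smul_mul, Matrix.mul_smul, e, smul_smul, ← key']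
  abel

/-- The pair `(q, q T)` is left coprime outside the closed disc. -/
theorem IsAdmissible.coprime (h : S.IsAdmissible X) {T : RatMatrix (Fin m) (Fin p)}
    (hT : IsRealization T S.A S.B S.C S.D) {α : OnePoint ℂ} (hα : α ∉ closedDisc) :
    (∀ i j, (S.q X * T) i j ∈ regularAt α) ∧ ∀ v : Fin m → ℂ,
      v ᵥ* matValue (S.q X) α = 0 → v ᵥ* matValue (S.q X * T) α = 0 → v = 0 := by
  obtain ⟨hw, hw1⟩ := inv_X_regular_of_notMem_closedDisc hα
  have hN := (h.hasValue_pencil_inv hα).2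
  have hL := (hasValue_const (α := α) (S.L X)).smul (sub_mem hw (one_mem _))
  have h1 := (((hasValue_const S.C).mul hN).mul hL).add hasValue_one
  have h2 := (((hasValue_const S.C).mul hN).mul (((hasValue_const S.B).smul hw).add
    (hL.mul (hasValue_const S.D)))).add (hasValue_const S.D)
  rw [← h.q_eq_pencil] at h1
  rw [← h.q_mul_eq hT] at h2
  refine ⟨h2.1, fun v hv1 hv2 => ?_⟩
  rw [h1.2] at hv1
  rw [h2.2] at hv2
  have hdet := (Matrix.isUnit_iff_isUnit_det _).mp (h.isUnit_value_full hw1)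
  rw [value_sub_one hw] at hv1 hv2
  set w := value (RatFunc.X)⁻¹ α
  set N := 1 - w • S.A - (w - 1) • (S.L X * S.C) with hNdef
  -- The vanishing of `v q` and `v q T` turns into `u = w u A` and `w u B = 0`. For `w ≠ 0`, `u`
  -- would be an uncontrollable left eigenvector for `1/w`; for `w = 0` the first equation already
  -- gives `u = 0`.
  set u := v ᵥ* (S.C * N⁻¹) with hu
  have e1 : (w - 1) • (u ᵥ* S.L X) + v = 0 := by
    rw [← hv1, Matrix.vecMul_add, Matrix.vecMul_one, ← Matrix.vecMul_vecMul, ← hu,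
      Matrix.vecMul_smul]
  have e2 : w • (u ᵥ* S.B) = 0 := by
    have : w • (u ᵥ* S.B) + ((w - 1) • (u ᵥ* S.L X) + v) ᵥ* S.D = 0 := by
      rw [← hv2, Matrix.vecMul_add, ← Matrix.vecMul_vecMul, ← hu, Matrix.vecMul_add,
        Matrix.vecMul_smul, ← Matrix.vecMul_vecMul, Matrix.vecMul_smul, Matrix.add_vecMul,
        add_assoc]
    rwa [e1, Matrix.zero_vecMul, add_zero] at this
  have e3 : u = w • (u ᵥ* S.A) := by
    have h3 : u ᵥ* N = v ᵥ* S.C := by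
      rw [hu, Matrix.vecMul_vecMul, Matrix.nonsing_inv_mul_cancel_right _ _ hdet]
    have h4 : u ᵥ* N + (((w - 1) • (u ᵥ* S.L X) + v) ᵥ* S.C) = u - w • (u ᵥ* S.A) + v ᵥ* S.C := by
      rw [hNdef, Matrix.vecMul_sub, Matrix.vecMul_sub, Matrix.vecMul_one, Matrix.vecMul_smul,
        Matrix.vecMul_smul, ← Matrix.vecMul_vecMul, Matrix.add_vecMul, Matrix.smul_vecMul]
      abel
    rw [e1, Matrix.zero_vecMul, add_zero, h3] at h4
    exact sub_eq_zero.mp (right_eq_add.mp h4)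
  have e4 : u = 0 := by
    by_cases hw0 : w = 0
    · rw [e3, hw0, zero_smul]
    · refine h.controllable u w⁻¹ ?_ ((smul_eq_zero.mp e2).resolve_left hw0)
      nth_rw 2 [e3]
      rw [smul_smul, inv_mul_cancel₀ hw0, one_smul]
  rw [e4, Matrix.zero_vecMul, smul_zero, zero_add] at e1
  exact e1

end

end BlockSystem

/-! ### Low-rank densities -/

section

variable {K : Type} [Field K] {a b : Type} [Fintype a] [DecidableEq a]

theorem isUnit_of_rank_eq_card {A : Matrix a a K} (h : A.rank = Fintype.card a) : IsUnit A := by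
  by_contra hu
  rw [Matrix.isUnit_iff_isUnit_det, isUnit_iff_ne_zero, not_not] at hu
  obtain ⟨v, hv, hA⟩ := Matrix.exists_mulVec_eq_zero_iff.mpr hu
  have h1 := LinearMap.finrank_range_add_finrank_ker A.mulVecLin
  have h2 : 0 < Module.finrank K (LinearMap.ker A.mulVecLin) := by
    have : Nontrivial (LinearMap.ker A.mulVecLin) :=
      ⟨⟨⟨v, hA⟩, 0, fun e => hv (congrArg Subtype.val e)⟩⟩
    exact Module.finrank_pos
  rw [← Matrix.rank, h, Module.finrank_fintype_fun_eq_card] at h1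
  omega

/-- If the rank of a block matrix is that of its invertible first block, the Schur complement
vanishes. -/
theorem toBlocks₂₂_eq_of_rank [Fintype b] {Φ : Matrix (a ⊕ b) (a ⊕ b) K}
    (hr : Φ.rank = Fintype.card a) (h : IsUnit Φ.toBlocks₁₁) :
    Φ.toBlocks₂₂ = Φ.toBlocks₂₁ * Φ.toBlocks₁₁⁻¹ * Φ.toBlocks₁₂ := by
  ext i j
  -- Border the first block by row `i` and column `j`. A nonzero Schur complement entry would make
  -- this submatrix invertible, of size one more than the rank.
  let f : a ⊕ Unit → a ⊕ b := Sum.map id fun _ => i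
  let g : a ⊕ Unit → a ⊕ b := Sum.map id fun _ => j
  by_contra hne
  have hinv := h.invertible
  have hblock : Φ.submatrix f g = Matrix.fromBlocks Φ.toBlocks₁₁
      (Φ.toBlocks₁₂.submatrix id fun _ : Unit => j) (Φ.toBlocks₂₁.submatrix (fun _ : Unit => i) id)
      (Φ.toBlocks₂₂.submatrix (fun _ : Unit => i) fun _ : Unit => j) := by
    ext (x | x) (y | y) <;> rfl
  have hu : IsUnit (Φ.submatrix f g) := by
    rw [Matrix.isUnit_iff_isUnit_det, hblock, Matrix.det_fromBlocks₁₁]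
    refine ((Matrix.isUnit_iff_isUnit_det _).mp h).mul ?_
    rw [Matrix.det_unique, isUnit_iff_ne_zero, Matrix.invOf_eq_nonsing_inv]
    exact sub_ne_zero.mpr hne
  have h1 := Matrix.rank_of_isUnit _ hu
  have h2 := Matrix.rank_submatrix_le Φ f g
  rw [h1, hr] at h2
  simp at h2

end

section

variable {a b : Type} [Fintype a] [DecidableEq a]
  {Φ : RatMatrix (a ⊕ b) (a ⊕ b)} {G : RatMatrix a a}

/-- The spectral factor `[G; H G]` of `Φ` that extends the factor `G` of `Φ₁₁`. -/
def stackedFactor (Φ : RatMatrix (a ⊕ b) (a ⊕ b)) (G : RatMatrix a a) : RatMatrix (a ⊕ b) a :=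
  Matrix.fromRows G (detRelation Φ * G)

theorem isSpectralFactor_stackedFactor [Fintype b] (hs : paraStar Φ = Φ) (hr : Φ.rank = Fintype.card a)
    (h : IsUnit Φ.toBlocks₁₁) (hG : IsSpectralFactor Φ.toBlocks₁₁ G) :
    IsSpectralFactor Φ (stackedFactor Φ G) := by
  have hdet := (Matrix.isUnit_iff_isUnit_det _).mp h
  have hG' : G * paraStar G = Φ.toBlocks₁₁ := hG.symm
  have h₁₁ : paraStar Φ.toBlocks₁₁ = Φ.toBlocks₁₁ := congrArg Matrix.toBlocks₁₁ hs
  have h₂₁ : paraStar Φ.toBlocks₂₁ = Φ.toBlocks₁₂ := congrArg Matrix.toBlocks₁₂ hs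
  have hH : detRelation Φ * Φ.toBlocks₁₁ = Φ.toBlocks₂₁ :=
    Matrix.nonsing_inv_mul_cancel_right _ _ hdet
  have hH' : Φ.toBlocks₁₁ * paraStar (detRelation Φ) = Φ.toBlocks₁₂ := by
    rw [← h₂₁, ← hH, paraStar_mul, h₁₁]
  rw [IsSpectralFactor, stackedFactor, paraStar_fromRows, Matrix.fromRows_mul_fromCols,
    paraStar_mul, hG', ← Matrix.mul_assoc, hG', hH', Matrix.mul_assoc, hG', hH, Matrix.mul_assoc,
    ← Matrix.mul_assoc G, hG', hH', detRelation, ← toBlocks₂₂_eq_of_rank hr h,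
    Matrix.fromBlocks_toBlocks]

/-- The top block `W₁` is invertible and `H = W₂ W₁⁻¹`, so the top block determines the bottom one.
The witness is `G⁻¹ W₁`. -/
theorem exists_paraUnitary_of_isSpectralFactor (h : IsUnit Φ.toBlocks₁₁)
    (hG : IsSpectralFactor Φ.toBlocks₁₁ G) {W : RatMatrix (a ⊕ b) a} (hW : IsSpectralFactor Φ W) :
    ∃ Q : RatMatrix a a, Q * paraStar Q = 1 ∧ W = stackedFactor Φ G * Q := by
  have hdet := (Matrix.isUnit_iff_isUnit_det _).mp h
  have hGu : IsUnit G := by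
    rw [hG] at h
    exact ((Matrix.isUnit_iff_isUnit_det _).mpr
      (isUnit_of_mul_isUnit_left (by rwa [Matrix.isUnit_iff_isUnit_det, Matrix.det_mul] at h)))
  have hGdet := (Matrix.isUnit_iff_isUnit_det _).mp hGu
  have hW' : Φ = Matrix.fromBlocks (W.toRows₁ * paraStar W.toRows₁)
      (W.toRows₁ * paraStar W.toRows₂) (W.toRows₂ * paraStar W.toRows₁)
      (W.toRows₂ * paraStar W.toRows₂) := by
    rw [← Matrix.fromRows_mul_fromCols, ← paraStar_fromRows, Matrix.fromRows_toRows]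
    exact hW
  have h1 : Φ.toBlocks₁₁ = W.toRows₁ * paraStar W.toRows₁ := by
    conv_lhs => rw [hW', Matrix.toBlocks_fromBlocks₁₁]
  have h2 : Φ.toBlocks₂₁ = W.toRows₂ * paraStar W.toRows₁ := by
    conv_lhs => rw [hW', Matrix.toBlocks_fromBlocks₂₁]
  have hsu : IsUnit (paraStar W.toRows₁).det := by
    rw [h1, Matrix.det_mul] at hdet
    exact isUnit_of_mul_isUnit_right hdet
  have hWu : IsUnit W.toRows₁.det := by
    rw [h1, Matrix.det_mul] at hdet
    exact isUnit_of_mul_isUnit_left hdet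
  have hGW : G * (G⁻¹ * W.toRows₁) = W.toRows₁ := Matrix.mul_nonsing_inv_cancel_left _ _ hGdet
  refine ⟨G⁻¹ * W.toRows₁, ?_, ?_⟩
  · have e : paraStar G * paraStar G⁻¹ = 1 := by
      rw [← paraStar_mul, Matrix.nonsing_inv_mul _ hGdet, paraStar_one]
    rw [paraStar_mul, Matrix.mul_assoc, ← Matrix.mul_assoc W.toRows₁, ← h1, hG, Matrix.mul_assoc,
      e, Matrix.mul_one, Matrix.nonsing_inv_mul _ hGdet]
  · rw [stackedFactor, Matrix.fromRows_mul, Matrix.mul_assoc, hGW, detRelation, h1, h2,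
      Matrix.mul_inv_rev, ← Matrix.mul_assoc, Matrix.mul_nonsing_inv_cancel_right _ _ hsu,
      Matrix.nonsing_inv_mul_cancel_right _ _ hWu, Matrix.fromRows_toRows]

theorem IsSpectralFactor.mul_paraUnitary {V : RatMatrix (a ⊕ b) a} (h : IsSpectralFactor Φ V)
    {Q : RatMatrix a a} (hQ : Q * paraStar Q = 1) : IsSpectralFactor Φ (V * Q) := by
  rw [IsSpectralFactor, paraStar_mul, Matrix.mul_assoc, ← Matrix.mul_assoc Q, hQ, Matrix.one_mul]
  exact h

theorem exists_unitary_of_minimumPhase_mul {V : RatMatrix (a ⊕ b) a} {Q₀ Q : RatMatrix a a}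
    (hQ₀ : Q₀ * paraStar Q₀ = 1) (hQ : Q * paraStar Q = 1) (h₀ : IsMinimumPhase (V * Q₀))
    (h : IsMinimumPhase (V * Q)) : ∃ U ∈ Matrix.unitaryGroup a ℂ, Q = Q₀ * const U := by
  have h1 : paraStar Q₀ * Q₀ = 1 := mul_eq_one_comm.mp hQ₀
  obtain ⟨U, hU, e⟩ := exists_unitary_of_isMinimumPhase (U := paraStar Q₀ * Q) h₀ h
    (by rw [paraStar_mul, paraStar_paraStar, Matrix.mul_assoc, ← Matrix.mul_assoc Q, hQ,
      Matrix.one_mul, h1])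
    (by rw [Matrix.mul_assoc, ← Matrix.mul_assoc Q₀, hQ₀, Matrix.one_mul])
  exact ⟨U, hU, by rw [← e, ← Matrix.mul_assoc, hQ₀, Matrix.one_mul]⟩

end

/-! ### The inner factor `Q₁` and minimum phase of the stacked factor -/

namespace BlockSystem

variable {m p nu ns : ℕ} {S : BlockSystem m p nu ns} {X : Matrix (Fin nu) (Fin nu) ℂ}

theorem transpose_mem_unitaryGroup {P : Matrix (Fin m) (Fin m) ℂ}
    (hP : P ∈ Matrix.unitaryGroup (Fin m) ℂ) : Pᵀ ∈ Matrix.unitaryGroup (Fin m) ℂ := by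
  rw [Matrix.mem_unitaryGroup_iff] at *
  have : Pᵀ * star Pᵀ = (star P * P)ᵀ := by
    rw [Matrix.transpose_mul]
    rfl
  rw [this, mul_eq_one_comm.mp hP, Matrix.transpose_one]

theorem IsAdmissible.Q₁_mul_paraStar (h : S.IsAdmissible X) {P : Matrix (Fin m) (Fin m) ℂ}
    (hP : P ∈ Matrix.unitaryGroup (Fin m) ℂ) : S.Q₁ X P * paraStar (S.Q₁ X P) = 1 := by
  have h1 : paraStar (S.q X) * S.q X = 1 := mul_eq_one_comm.mp h.q_mul_paraStar
  have h2 : const Pᴴ * const P = 1 := by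
    rw [← const_mul, ← Matrix.star_eq_conjTranspose, Matrix.mem_unitaryGroup_iff'.mp hP, const_one]
  have e : paraStar (const P * S.q X)ᵀ = (paraStar (const P * S.q X))ᵀ := rfl
  rw [Q₁_eq, e, ← Matrix.transpose_mul, paraStar_mul, paraStar_const, Matrix.mul_assoc,
    ← Matrix.mul_assoc _ (const P), h2, Matrix.one_mul, h1, Matrix.transpose_one]

theorem IsAdmissible.Q₁_regular (h : S.IsAdmissible X) (P : Matrix (Fin m) (Fin m) ℂ)
    {α : OnePoint ℂ} (hα : α ∉ openDisc) :
    HasValue (S.Q₁ X P) α (P * matValue (S.q X) α)ᵀ := by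
  rw [Q₁_eq]
  exact ((hasValue_const P).mul ⟨h.q_regular hα, rfl⟩).transpose

theorem IsAdmissible.isInner_Q₁ (h : S.IsAdmissible X) {P : Matrix (Fin m) (Fin m) ℂ}
    (hP : P ∈ Matrix.unitaryGroup (Fin m) ℂ) : IsInner (S.Q₁ X P) :=
  ⟨isStable_iff.mpr fun _ hα => (h.Q₁_regular P hα).1, h.Q₁_mul_paraStar hP,
    mul_eq_one_comm.mp (h.Q₁_mul_paraStar hP)⟩

variable {Φ : RatMatrix (Fin m ⊕ Fin p) (Fin m ⊕ Fin p)} {G : RatMatrix (Fin m) (Fin m)}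

theorem IsAdmissible.fromRows_eq (h : S.IsAdmissible X)
    (hT : IsRealization (Gᵀ * (detRelation Φ)ᵀ) S.A S.B S.C S.D) (P : Matrix (Fin m) (Fin m) ℂ) :
    Matrix.fromRows (G * S.Q₁ X P) (S.W₂ X P) = stackedFactor Φ G * S.Q₁ X P := by
  rw [stackedFactor, Matrix.fromRows_mul, h.W₂_eq hT, Q₁_eq, ← Matrix.transpose_mul,
    ← Matrix.mul_assoc]
  simp only [Matrix.transpose_mul, Matrix.transpose_transpose, Matrix.mul_assoc]

/-- Outside the closed disc everything follows from coprimeness and from `G` having no zeros there.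
On the circle the pencil may be singular, and regularity comes from `Φ = W W^*` instead. -/
theorem IsAdmissible.isMinimumPhase (h : S.IsAdmissible X)
    (hT : IsRealization (Gᵀ * (detRelation Φ)ᵀ) S.A S.B S.C S.D) (hΦ : IsSpectralDensity Φ)
    (hG : IsMinimumPhase G) {P : Matrix (Fin m) (Fin m) ℂ}
    (hP : P ∈ Matrix.unitaryGroup (Fin m) ℂ)
    (hW : IsSpectralFactor Φ (Matrix.fromRows (G * S.Q₁ X P) (S.W₂ X P))) :
    IsMinimumPhase (Matrix.fromRows (G * S.Q₁ X P) (S.W₂ X P)) := by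
  have hval {α : OnePoint ℂ} (hα : α ∉ closedDisc) :
      HasValue (Matrix.fromRows (G * S.Q₁ X P) (S.W₂ X P)) α
        (Matrix.fromRows (matValue G α * (P * matValue (S.q X) α)ᵀ)
          (P * matValue (S.q X * (Gᵀ * (detRelation Φ)ᵀ)) α)ᵀ) := by
    have hα' := notMem_openDisc_of_notMem_closedDisc hα
    refine ((hG.hasValue hα').mul (h.Q₁_regular P hα')).fromRows ?_
    rw [h.W₂_eq hT]
    exact ((hasValue_const P).mul ⟨(h.coprime hT hα).1, rfl⟩).transpose
  constructor
  · refine isStable_iff.mpr fun α hα => ?_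
    rcases mem_or_of_notMem_openDisc hα with hα | ⟨z, hz, rfl⟩
    · exact (hval hα).1
    · refine regular_of_mul_paraStar hz ?_
      rw [← hW]
      exact not_isMatPole_iff.mp (hΦ.2 z hz).1
  · rintro α ⟨-, v, hv, hv0⟩
    by_contra hα
    rw [(hval hα).2, Matrix.fromRows_mulVec] at hv0
    have h1 : (matValue G α * (P * matValue (S.q X) α)ᵀ) *ᵥ v = 0 :=
      funext fun i => congrFun hv0 (Sum.inl i)
    have h2 : (P * matValue (S.q X * (Gᵀ * (detRelation Φ)ᵀ)) α)ᵀ *ᵥ v = 0 :=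
      funext fun i => congrFun hv0 (Sum.inr i)
    rw [← Matrix.mulVec_mulVec] at h1
    have h3 := hG.eq_zero hα h1
    rw [Matrix.mulVec_transpose, ← Matrix.vecMul_vecMul] at h2 h3
    have h4 := (h.coprime hT hα).2 _ h3 h2
    refine hv ?_
    rw [← Matrix.vecMul_one v, ← Matrix.mem_unitaryGroup_iff.mp hP, ← Matrix.vecMul_vecMul, h4,
      Matrix.zero_vecMul]

end BlockSystem

end LowRankSpectral

end

/-! ### The main theorem -/

open LowRankSpectral in
theorem theorem3p3 {m p : ℕ} (hm : 0 < m)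
    (Φ : RatMatrix (Fin m ⊕ Fin p) (Fin m ⊕ Fin p))
    (hΦ : IsSpectralDensity Φ) (hrank : Φ.rank = m) (hrank₁₁ : Φ.toBlocks₁₁.rank = m)
    (G₁ : RatMatrix (Fin m) (Fin m))
    (hG₁ : IsSpectralFactor Φ.toBlocks₁₁ G₁) (hG₁min : IsMinimumPhase G₁)
    {nu ns : ℕ} (S : BlockSystem m p nu ns)
    (hS : S.IsSplitMinimalRealization (G₁ᵀ * (detRelation Φ)ᵀ)) :
    ∃ X : Matrix (Fin nu) (Fin nu) ℂ,
      -- `X` is Hermitian, invertible, and the only solution of the Stein equation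
      (S.Stein X ∧ X.IsHermitian ∧ IsUnit X ∧ ∀ Y, S.Stein Y → Y = X) ∧
      -- `Q₁` is inner
      (∀ P ∈ Matrix.unitaryGroup (Fin m) ℂ, IsInner (S.Q₁ X P)) ∧
      -- all the minimum-phase full-column-rank spectral factors
      (∀ W : RatMatrix (Fin m ⊕ Fin p) (Fin m),
        (IsSpectralFactor Φ W ∧ W.rank = m ∧ IsMinimumPhase W) ↔
          ∃ P ∈ Matrix.unitaryGroup (Fin m) ℂ,
            W = Matrix.fromRows (G₁ * S.Q₁ X P) (S.W₂ X P)) ∧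
      -- once `P` is chosen, the pair `(Q₁, W₂)` is the same for every split minimal realization
      (∀ (nu' ns' : ℕ) (S' : BlockSystem m p nu' ns'),
        S'.IsSplitMinimalRealization (G₁ᵀ * (detRelation Φ)ᵀ) →
        ∀ X' : Matrix (Fin nu') (Fin nu') ℂ, S'.Stein X' →
        ∀ P ∈ Matrix.unitaryGroup (Fin m) ℂ,
          S'.Q₁ X' P = S.Q₁ X P ∧ S'.W₂ X' P = S.W₂ X P) := by
  have h₁₁ : IsUnit Φ.toBlocks₁₁ := isUnit_of_rank_eq_card (by rw [hrank₁₁, Fintype.card_fin])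
  have hrank' : Φ.rank = Fintype.card (Fin m) := by rw [hrank, Fintype.card_fin]
  have hK := isSpectralFactor_stackedFactor hΦ.1 hrank' h₁₁ hG₁
  have hone : (1 : Matrix (Fin m) (Fin m) ℂ) ∈ Matrix.unitaryGroup (Fin m) ℂ := one_mem _
  -- For every admissible system the matrices of the theorem are minimum-phase spectral factors.
  have hfac {nu' ns' : ℕ} {S' : BlockSystem m p nu' ns'}
      (hS' : S'.IsSplitMinimalRealization (G₁ᵀ * (detRelation Φ)ᵀ))
      {Y : Matrix (Fin nu') (Fin nu') ℂ} (hY : S'.IsAdmissible Y) {P : Matrix (Fin m) (Fin m) ℂ}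
      (hP : P ∈ Matrix.unitaryGroup (Fin m) ℂ) :
      IsSpectralFactor Φ (stackedFactor Φ G₁ * S'.Q₁ Y P) ∧
        IsMinimumPhase (stackedFactor Φ G₁ * S'.Q₁ Y P) := by
    have h1 := hK.mul_paraUnitary (hY.Q₁_mul_paraStar hP)
    refine ⟨h1, ?_⟩
    rw [← hY.fromRows_eq hS'.1.1] at h1 ⊢
    exact hY.isMinimumPhase hS'.1.1 hΦ hG₁min hP h1
  obtain ⟨X, hX, huniq⟩ := S.existsUnique_stein_of_minimal hS
  refine ⟨X, ⟨hX.stein, hX.hermitian, hX.isUnit, huniq⟩, fun P hP => hX.isInner_Q₁ hP,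
    fun W => ⟨?_, ?_⟩, ?_⟩
  · rintro ⟨hW, -, hWmin⟩
    obtain ⟨Q, hQ, rfl⟩ := exists_paraUnitary_of_isSpectralFactor h₁₁ hG₁ hW
    obtain ⟨U, hU, rfl⟩ := exists_unitary_of_minimumPhase_mul (hX.Q₁_mul_paraStar hone) hQ
      (hfac hS hX hone).2 hWmin
    -- `P` acts on `q` from the left before transposition, so a right factor `U` of `Q₁` corresponds
    -- to `P = Uᵀ`.
    refine ⟨Uᵀ, BlockSystem.transpose_mem_unitaryGroup hU, ?_⟩
    rw [hX.fromRows_eq hS.1.1, BlockSystem.Q₁_eq, BlockSystem.Q₁_eq, const_one, Matrix.one_mul,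
      Matrix.transpose_mul]
    rfl
  · rintro ⟨P, hP, rfl⟩
    rw [hX.fromRows_eq hS.1.1]
    obtain ⟨h1, h2⟩ := hfac hS hX hP
    refine ⟨h1, le_antisymm ?_ ?_, h2⟩
    · simpa using Matrix.rank_le_card_width (stackedFactor Φ G₁ * S.Q₁ X P)
    · conv_lhs => rw [← hrank, h1]
      exact Matrix.rank_mul_le_left _ _
  · intro nu' ns' S' hS' X' hX' P _
    obtain ⟨Y, hY, hYuniq⟩ := S'.existsUnique_stein_of_minimal hS'
    obtain rfl := hYuniq X' hX'
    -- It suffices to compare at `P = 1`. There the two inner factors differ by a constant, which is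
    -- `1` because both equal the identity at `z = 1`.
    obtain ⟨U, -, hU⟩ := exists_unitary_of_minimumPhase_mul (hX.Q₁_mul_paraStar hone)
      (hY.Q₁_mul_paraStar hone) (hfac hS hX hone).2 (hfac hS' hY hone).2
    rw [BlockSystem.Q₁_eq, BlockSystem.Q₁_eq, const_one, Matrix.one_mul, Matrix.one_mul] at hU
    have hU1 : U = 1 := by
      have h1 := hX.hasValue_q_one.transpose.mul (hasValue_const U)
      rw [← hU] at h1
      have h2 := h1.2.symm.trans hY.hasValue_q_one.transpose.2
      simpa using h2
    have hq : S'.q X' = S.q X := by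
      rw [hU1, const_one, Matrix.mul_one] at hU
      exact Matrix.transpose_injective hU
    rw [BlockSystem.Q₁_eq, BlockSystem.Q₁_eq, hY.W₂_eq hS'.1.1, hX.W₂_eq hS.1.1, hq]
    exact ⟨rfl, rfl⟩
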